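/- **Theorem (Validity of the local permutation test under $\gamma$-Hellinger Lipschitzness).** For every $\gamma\ge 1$ there is a constant $C_\gamma>0$, depending only on $\gamma$, such that the following holds. *Setting.* Let $\mathcal X,\mathcal Y$ be measurable spaces and let $\mathcal Z$ be a measurable space equipped with a metric $\delta$ (for instance a compact subset of $\mathbb R^d$ with the Euclidean distance). Let $B_1,\dots,B_M$ be a measurable partition of $\mathcal Z$ into bins of finite diameter (automatic if $\mathcal Z$ is compact), and put $h=\max_{1\le m\le M}\sup_{z,z'\in B_m}\delta(z,z')$ (with $\sup\emptyset=0$). *Null class.* For probability measures $P,Q$ with densities $p,q$ with respect to a common dominating measure $\mu$, let $$\mathcal D_{\gamma,\mathrm H}(P,Q)=\Big(\tfrac12\int |p^{1/\gamma}-q^{1/\gamma}|^{\gamma}\,d\mu\Big)^{1/\gamma}.$$ For $L\ge 0$ let $\mathcal P_{0,\mathrm H,\gamma,\delta}(L)$ be the set of distributions $P_{X,Y,Z}$ on $\mathcal X\times\mathcal Y\times\mathcal Z$ that admit conditional distributions (Markov kernels) $P_{X|Z=z}$, $P_{Y|Z=z}$ such that $X$ and $Y$ are conditionally independent given $Z$,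 i.e. $P_{X,Y|Z=z}=P_{X|Z=z}\otimes P_{Y|Z=z}$, and such that for all $z,z'\in\mathcal Z$ $$\mathcal D_{\gamma,\mathrm H}(P_{X|Z=z},P_{X|Z=z'})\le L\,\delta(z,z'),\qquad \mathcal D_{\gamma,\mathrm H}(P_{Y|Z=z},P_{Y|Z=z'})\le L\,\delta(z,z').$$ *Test.* Given observations $(X_i,Y_i,Z_i)_{i=1}^n$, let $\sigma_m$ be the number of $i$ with $Z_i\in B_m$, and let $W_m=((X_{1,m},Y_{1,m}),\dots,(X_{\sigma_m,m},Y_{\sigma_m,m}))$ be the list of the pairs $(X_i,Y_i)$ with $Z_i\in B_m$, in the order of the sample. Let $f$ be any real-valued measurable function of $(W_1,\dots,W_M)$. For $\boldsymbol\pi=(\pi_1,\dots,\pi_M)$, with $\pi_m$ a permutation of $\{1,\dots,\sigma_m\}$, let $W_m^{\pi_m}=((X_{1,m},Y_{\pi_m(1),m}),\dots,(X_{\sigma_m,m},Y_{\pi_m(\sigma_m),m}))$. Put $$p_{\mathrm{perm}}=\frac1{\prod_{m}\sigma_m!}\sum_{\boldsymbol\pi}\mathbf 1\{f(W_1^{\pi_1},\dots,W_M^{\pi_M})\ge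 f(W_1,\dots,W_M)\},\qquad \phi_{\mathrm{perm},n}=\mathbf 1\{p_{\mathrm{perm}}\le\alpha\}.$$ *Conclusion.* For all $\alpha\in(0,1)$, $L\ge 0$, $n$ and $M$, and all partitions and statistics $f$ as above, $$\sup_{P\in\mathcal P_{0,\mathrm H,\gamma,\delta}(L)}\mathbb E_{P^{n}}[\phi_{\mathrm{perm},n}]\ \le\ \begin{cases}\alpha+C_\gamma\,n^{1/2}L^{\gamma}h^{\gamma}, & \gamma\in[1,2],\\ \alpha+C_\gamma\,n^{1/2}L^{2}h^{2}, & \gamma>2,\end{cases}$$ where $P^n$ is the law of $n$ i.i.d. observations from $P$. The supremum is over a set that may be empty, in which case there is nothing to claim. -/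

import Mathlib

open MeasureTheory ProbabilityTheory
open scoped Nat

noncomputable section

namespace LocalPerm

/-- The generalized Hellinger distance with parameter `γ` between two probability measures,
`(½ ∫ |p^{1/γ} - q^{1/γ}|^γ dμ)^{1/γ}`, written with the common dominating measure `μ = P + Q`
and `p = dP/dμ`, `q = dQ/dμ` (the value does not depend on the dominating measure). -/
def genHellinger {Ω : Type*} [MeasurableSpace Ω] (γ : ℝ) (P Q : Measure Ω) : ℝ :=
  ((1 / 2) * ∫ ω, |(P.rnDeriv (P + Q) ω).toReal ^ (1 / γ)
      - (Q.rnDeriv (P + Q) ω).toReal ^ (1 / γ)| ^ γ ∂(P + Q)) ^ (1 / γ)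

/-- `κ` is a version of the conditional distribution of `U` given `Z` under `P`: the law of
`(Z, U)` is `P_Z(dz) κ(z, du)`. -/
def IsCondLaw {Ω E 𝒵 : Type*} [MeasurableSpace Ω] [MeasurableSpace E] [MeasurableSpace 𝒵]
    (P : Measure Ω) (U : Ω → E) (Z : Ω → 𝒵) (κ : Kernel 𝒵 E) : Prop :=
  P.map (fun ω => (Z ω, U ω)) = P.map Z ⊗ₘ κ

/-- The `γ`-Hellinger Lipschitz null class with constant `L`: the laws `P` of `(X, Y, Z)` with
conditional distributions `κ` of `X | Z` and `η` of `Y | Z` such that the conditional distribution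
of `(X, Y) | Z` is the product of the two (that is, `X` and `Y` are conditionally independent given
`Z`), and such that `z ↦ κ z` and `z ↦ η z` are `L`-Lipschitz on all of `𝒵` in the generalized
Hellinger distance with parameter `γ`. -/
def hellingerNull {𝒳 𝒴 𝒵 : Type*} [MeasurableSpace 𝒳] [MeasurableSpace 𝒴] [MeasurableSpace 𝒵]
    [MetricSpace 𝒵] (γ L : ℝ) : Set (Measure (𝒳 × 𝒴 × 𝒵)) :=
  {P | IsProbabilityMeasure P ∧
    ∃ (κ : Kernel 𝒵 𝒳) (η : Kernel 𝒵 𝒴), IsMarkovKernel κ ∧ IsMarkovKernel η ∧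
      IsCondLaw P (fun ω => ω.1) (fun ω => ω.2.2) κ ∧
      IsCondLaw P (fun ω => ω.2.1) (fun ω => ω.2.2) η ∧
      IsCondLaw P (fun ω => (ω.1, ω.2.1)) (fun ω => ω.2.2) (κ ×ₖ η) ∧
      ∀ z z' : 𝒵, genHellinger γ (κ z) (κ z') ≤ L * dist z z' ∧
        genHellinger γ (η z) (η z') ≤ L * dist z z'}

/-- `B 0, …, B (M-1)` is a measurable partition of `𝒵` (some of the bins may be empty). -/
structure IsBinning {𝒵 : Type*} [MeasurableSpace 𝒵] {M : ℕ} (B : Fin M → Set 𝒵) : Prop where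
  measurableSet : ∀ m, MeasurableSet (B m)
  disjoint : Pairwise fun m m' => Disjoint (B m) (B m')
  iUnion_eq : ⋃ m, B m = Set.univ

/-- The maximum diameter of the bins. -/
def maxDiam {𝒵 : Type*} [MetricSpace 𝒵] {M : ℕ} (B : Fin M → Set 𝒵) : ℝ :=
  ⨆ m, Metric.diam (B m)

/-- The content of one bin: its sample size `σ` and the pairs `(X_{1}, Y_{1}), …, (X_{σ}, Y_{σ})`.-/
abbrev BinData (𝒳 𝒴 : Type*) : Type _ := Σ σ : ℕ, Fin σ → 𝒳 × 𝒴

/-- The locally permuted bin `{(X_1, Y_{π(1)}), …, (X_σ, Y_{π(σ)})}`. -/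
def BinData.permute {𝒳 𝒴 : Type*} (W : BinData 𝒳 𝒴) (π : Equiv.Perm (Fin W.1)) : BinData 𝒳 𝒴 :=
  ⟨W.1, fun j => ((W.2 j).1, (W.2 (π j)).2)⟩

section Data

variable {𝒳 𝒴 𝒵 : Type*} {M n : ℕ}

open Classical in
/-- The indices `i` of the observations with `Z_i ∈ B m`. -/
def binIndices (B : Fin M → Set 𝒵) (s : Fin n → 𝒳 × 𝒴 × 𝒵) (m : Fin M) : Finset (Fin n) :=
  Finset.univ.filter fun i => (s i).2.2 ∈ B m

/-- The binned data `W_1, …, W_M`: in every bin, the pairs `(X_i, Y_i)` with `Z_i ∈ B m`, listed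
in the order of the original sample. -/
def binnedData (B : Fin M → Set 𝒵) (s : Fin n → 𝒳 × 𝒴 × 𝒵) (m : Fin M) : BinData 𝒳 𝒴 :=
  ⟨(binIndices B s m).card, fun j =>
    ((s ((binIndices B s m).orderEmbOfFin rfl j)).1,
      (s ((binIndices B s m).orderEmbOfFin rfl j)).2.1)⟩

open Classical in
/-- The permutation p-value `K⁻¹ ∑_π 1{T^π ≥ T}`, `K = ∏ σ_m!`, of the statistic `f`; the sum is
over all tuples `π = (π_1, …, π_M)` of permutations within the bins. -/
def permPValue (f : (Fin M → BinData 𝒳 𝒴) → ℝ) (W : Fin M → BinData 𝒳 𝒴) : ℝ :=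
  (1 / ((∏ m, (W m).1 ! : ℕ) : ℝ)) *
    ∑ π : ((m : Fin M) → Equiv.Perm (Fin (W m).1)),
      if f (fun m => (W m).permute (π m)) ≥ f W then (1 : ℝ) else 0

open Classical in
/-- The local permutation test: `1` (reject) if the p-value is at most `α`, else `0`. -/
def permTest (B : Fin M → Set 𝒵) (f : (Fin M → BinData 𝒳 𝒴) → ℝ) (α : ℝ)
    (s : Fin n → 𝒳 × 𝒴 × 𝒵) : ℝ :=
  if permPValue f (binnedData B s) ≤ α then 1 else 0

end Data

end LocalPerm

end

/-!
The law `P` of an observation is compared with a law under which the local permutation test is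
exactly valid. Write `κ z`, `η z` for the conditional laws of `X` and `Y` given `Z = z`. The test
sees `Z` only through the label of its bin, and given the label `m` the pair `(X, Y)` has the law
`P_m`, the average of `κ z ⊗ η z` over the bin. Let `Q_m` be the product of the marginals of `P_m`,
and let `Q` be the law of a labelled observation in which `P_m` is replaced by `Q_m`. Given the
labels, local permutations preserve the law of `n` observations from `Q`, so the test has level `α`
under `Qⁿ` (`integral_permTest_le_of_independent`, by the rank argument of `sum_rank_le`). It
remains to bound the total variation distance of `Pⁿ` and `Qⁿ` by a multiple of `√n ε`, where `ε`
bounds the squared Hellinger distances of `κ z, κ z'` and of `η z, η z'` for `z, z'` in one bin.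

The point is that the squared Hellinger distance of `P` and `Q` is of order `ε²`, not `ε`.
Indeed `P_m - Q_m` is half the average of `(κ z - κ z') ⊗ (η z - η z')` over independent `z, z'`.
Writing a difference of densities as `a - a' = (√a - √a') (√a + √a')`, the arithmetic-geometric
mean inequality bounds the integral of a test function `θ` against this product by `8 ε²`
plus half of the integral of `θ²` against `(κ z + κ z') ⊗ (η z + η z')`
(`integral_prod_second_difference_le`). The kernels `κ`, `η` need not have jointly measurable
densities, so the estimate is averaged over `z, z'` in this variational form (`VarBound`,
`varBound_mixture`), and only then specialized to the test function `(p - q) / (p + q)`, which gives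
a bound on `∫ (p - q)² / (p + q)` and hence on the squared Hellinger distance
(`VarBound.sqHellinger_le`). The multiplicativity of the Hellinger affinity then yields the bound
for `n` observations (`integral_pi_sub_le`).

Finally, `ε` is of order `(L h) ^ γ` for `γ ≤ 2`, because `t ↦ t ^ (γ / 2)` is subadditive
(`sqHellinger_le_of_le_two`), and of order `(L h) ^ 2` for `γ > 2`, by the mean value inequality for
`t ↦ t ^ (γ / 2)` and Hölder's inequality (`sqHellinger_le_of_two_lt`).
-/

namespace LocalPerm

/-! ### The generalized Hellinger distance and the squared Hellinger distance -/

section Hellinger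

/-- The squared Hellinger distance `½ ∫ (√p - √q)² dμ`, with the dominating measure
`μ = P + Q` as in `genHellinger`. -/
noncomputable def sqHellinger {Ω : Type*} [MeasurableSpace Ω] (P Q : Measure Ω) : ℝ :=
  (1 / 2) * ∫ ω, (√(P.rnDeriv (P + Q) ω).toReal - √(Q.rnDeriv (P + Q) ω).toReal) ^ 2 ∂(P + Q)

lemma sq_sqrt_sub_sqrt_le_of_le_two {γ a b : ℝ} (h1 : 1 ≤ γ) (h2 : γ ≤ 2) (ha : 0 ≤ a)
    (hb : 0 ≤ b) : (√a - √b) ^ 2 ≤ |a ^ (1 / γ) - b ^ (1 / γ)| ^ γ := by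
  wlog hab : b ≤ a generalizing a b
  · have := this hb ha (le_of_not_ge hab)
    rwa [abs_sub_comm, ← neg_sub, neg_sq] at this
  have hγ : 0 < γ := by linarith
  set u := a ^ (1 / γ) with hu
  set v := b ^ (1 / γ) with hv
  have hv0 : 0 ≤ v := by positivity
  have huv : v ≤ u := Real.rpow_le_rpow hb hab (by positivity)
  have hsa : √a = u ^ (γ / 2) := by
    rw [hu, ← Real.rpow_mul ha, Real.sqrt_eq_rpow]; congr 1; field_simp
  have hsb : √b = v ^ (γ / 2) := by
    rw [hv, ← Real.rpow_mul hb, Real.sqrt_eq_rpow]; congr 1; field_simp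
  have key : √a ≤ (u - v) ^ (γ / 2) + √b := by
    rw [hsa, hsb]
    have := Real.rpow_add_le_add_rpow (sub_nonneg.2 huv) hv0 (p := γ / 2) (by positivity)
      (by linarith)
    simpa using this
  have hsab : √b ≤ √a := Real.sqrt_le_sqrt hab
  rw [abs_of_nonneg (sub_nonneg.2 huv)]
  calc (√a - √b) ^ 2 ≤ ((u - v) ^ (γ / 2)) ^ 2 :=
        pow_le_pow_left₀ (by linarith) (by linarith) 2
    _ = (u - v) ^ γ := by
        rw [← Real.rpow_natCast, ← Real.rpow_mul (sub_nonneg.2 huv)]; congr 1; push_cast; ring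

/-- The mean value inequality for `t ↦ t ^ (γ / 2)`, in terms of `u = a ^ (1 / γ)` and
`v = b ^ (1 / γ)`. -/
lemma sq_sqrt_sub_sqrt_le_of_two_lt {γ a b : ℝ} (h2 : 2 < γ) (ha : 0 ≤ a) (hb : 0 ≤ b) :
    (√a - √b) ^ 2 ≤
      γ ^ 2 / 4 * (|a ^ (1 / γ) - b ^ (1 / γ)| ^ 2 * (a + b) ^ ((γ - 2) / γ)) := by
  wlog hab : b ≤ a generalizing a b
  · have := this hb ha (le_of_not_ge hab)
    rwa [abs_sub_comm, ← neg_sub, neg_sq, add_comm] at this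
  have hγ : 0 < γ := by linarith
  rcases ha.eq_or_lt with rfl | ha'
  · obtain rfl : b = 0 := le_antisymm hab hb
    simp
  set u := a ^ (1 / γ) with hu
  set v := b ^ (1 / γ) with hv
  have hv0 : 0 ≤ v := by positivity
  have hu0 : 0 < u := by positivity
  have huv : v ≤ u := Real.rpow_le_rpow hb hab (by positivity)
  have hsa : √a = u ^ (γ / 2) := by
    rw [hu, ← Real.rpow_mul ha, Real.sqrt_eq_rpow]; congr 1; field_simp
  have hsb : √b = v ^ (γ / 2) := by
    rw [hv, ← Real.rpow_mul hb, Real.sqrt_eq_rpow]; congr 1; field_simp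
  have hsab : √b ≤ √a := Real.sqrt_le_sqrt hab
  have hvu : 0 ≤ v / u := by positivity
  -- Bernoulli's inequality at `v / u` is the convexity of the power function
  have hB := one_add_mul_self_le_rpow_one_add (s := v / u - 1) (by linarith) (p := γ / 2)
    (by linarith)
  rw [add_sub_cancel, Real.div_rpow hv0 hu0.le, le_div_iff₀ (by positivity), ← hsa, ← hsb] at hB
  have hpow : √a = u ^ (γ / 2 - 1) * u := by
    rw [hsa, ← Real.rpow_add_one hu0.ne']; congr 1; ring
  have key : √a - √b ≤ γ / 2 * ((u - v) * u ^ (γ / 2 - 1)) := by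
    have e : (1 + γ / 2 * (v / u - 1)) * √a = √a + γ / 2 * (v / u - 1) * (u ^ (γ / 2 - 1) * u) := by
      rw [add_mul, one_mul, ← hpow]
    have e2 : γ / 2 * (v / u - 1) * (u ^ (γ / 2 - 1) * u)
        = - (γ / 2 * ((u - v) * u ^ (γ / 2 - 1))) := by
      field_simp; ring
    linarith
  have hup : (u ^ (γ / 2 - 1)) ^ 2 = a ^ ((γ - 2) / γ) := by
    rw [hu, ← Real.rpow_natCast, ← Real.rpow_mul ha, ← Real.rpow_mul ha]
    congr 1; push_cast; field_simp
  rw [sq_abs]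
  calc (√a - √b) ^ 2 ≤ (γ / 2 * ((u - v) * u ^ (γ / 2 - 1))) ^ 2 :=
        pow_le_pow_left₀ (by linarith) key 2
    _ = γ ^ 2 / 4 * ((u - v) ^ 2 * a ^ ((γ - 2) / γ)) := by rw [← hup]; ring
    _ ≤ _ := by
        have : a ^ ((γ - 2) / γ) ≤ (a + b) ^ ((γ - 2) / γ) :=
          Real.rpow_le_rpow ha (by linarith) (div_nonneg (by linarith) hγ.le)
        gcongr

variable {Ω : Type*} [MeasurableSpace Ω] {P Q : Measure Ω}

lemma integrable_toReal_rnDeriv_add [IsFiniteMeasure P] [IsFiniteMeasure Q] :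
    Integrable (fun ω => (P.rnDeriv (P + Q) ω).toReal + (Q.rnDeriv (P + Q) ω).toReal) (P + Q) :=
  Measure.integrable_toReal_rnDeriv.add Measure.integrable_toReal_rnDeriv

lemma integral_toReal_rnDeriv_add [IsProbabilityMeasure P] [IsProbabilityMeasure Q] :
    ∫ ω, ((P.rnDeriv (P + Q) ω).toReal + (Q.rnDeriv (P + Q) ω).toReal) ∂(P + Q) = 2 := by
  rw [integral_add Measure.integrable_toReal_rnDeriv Measure.integrable_toReal_rnDeriv,
    Measure.integral_toReal_rnDeriv (Measure.AbsolutelyContinuous.rfl.add_right Q),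
    Measure.integral_toReal_rnDeriv (by
      rw [add_comm]; exact Measure.AbsolutelyContinuous.rfl.add_right P)]
  simp; norm_num

lemma integrable_sq_sqrt_rnDeriv_sub [IsFiniteMeasure P] [IsFiniteMeasure Q] :
    Integrable (fun ω =>
      (√(P.rnDeriv (P + Q) ω).toReal - √(Q.rnDeriv (P + Q) ω).toReal) ^ 2) (P + Q) := by
  refine (integrable_toReal_rnDeriv_add (P := P) (Q := Q)).mono' (by fun_prop)
    (Filter.Eventually.of_forall fun ω => ?_)
  have h1 := Real.sq_sqrt (ENNReal.toReal_nonneg (a := P.rnDeriv (P + Q) ω))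
  have h2 := Real.sq_sqrt (ENNReal.toReal_nonneg (a := Q.rnDeriv (P + Q) ω))
  rw [Real.norm_of_nonneg (sq_nonneg _)]
  nlinarith [Real.sqrt_nonneg (P.rnDeriv (P + Q) ω).toReal,
    Real.sqrt_nonneg (Q.rnDeriv (P + Q) ω).toReal]

/-- The integrand of `genHellinger` is bounded by the sum of the densities, hence integrable. -/
lemma abs_rpow_inv_sub_le {γ a b : ℝ} (h1 : 1 ≤ γ) (ha : 0 ≤ a) (hb : 0 ≤ b) :
    |a ^ (1 / γ) - b ^ (1 / γ)| ^ γ ≤ a + b := by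
  wlog hab : b ≤ a generalizing a b
  · have := this hb ha (le_of_not_ge hab)
    rwa [abs_sub_comm, add_comm] at this
  have hγ : 0 < γ := by linarith
  have huv : b ^ (1 / γ) ≤ a ^ (1 / γ) := Real.rpow_le_rpow hb hab (by positivity)
  rw [abs_of_nonneg (sub_nonneg.2 huv)]
  calc (a ^ (1 / γ) - b ^ (1 / γ)) ^ γ ≤ (a ^ (1 / γ)) ^ γ :=
        Real.rpow_le_rpow (sub_nonneg.2 huv) (sub_le_self _ (by positivity)) hγ.le
    _ = a := by rw [← Real.rpow_mul ha, one_div_mul_cancel hγ.ne', Real.rpow_one]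
    _ ≤ a + b := by linarith

lemma integrable_abs_rpow_rnDeriv_sub {γ : ℝ} (h1 : 1 ≤ γ) [IsFiniteMeasure P]
    [IsFiniteMeasure Q] :
    Integrable (fun ω => |(P.rnDeriv (P + Q) ω).toReal ^ (1 / γ)
      - (Q.rnDeriv (P + Q) ω).toReal ^ (1 / γ)| ^ γ) (P + Q) := by
  refine (integrable_toReal_rnDeriv_add (P := P) (Q := Q)).mono'
    (Measurable.aestronglyMeasurable (by fun_prop)) (Filter.Eventually.of_forall fun ω => ?_)
  rw [Real.norm_of_nonneg (by positivity)]
  exact abs_rpow_inv_sub_le h1 ENNReal.toReal_nonneg ENNReal.toReal_nonneg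

lemma half_integral_le_of_genHellinger_le {γ δ : ℝ} (h1 : 1 ≤ γ) (h : genHellinger γ P Q ≤ δ) :
    (1 / 2) * ∫ ω, |(P.rnDeriv (P + Q) ω).toReal ^ (1 / γ)
      - (Q.rnDeriv (P + Q) ω).toReal ^ (1 / γ)| ^ γ ∂(P + Q) ≤ δ ^ γ := by
  have hγ : 0 < γ := by linarith
  have h0 : 0 ≤ (1 / 2) * ∫ ω, |(P.rnDeriv (P + Q) ω).toReal ^ (1 / γ)
      - (Q.rnDeriv (P + Q) ω).toReal ^ (1 / γ)| ^ γ ∂(P + Q) :=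
    mul_nonneg (by norm_num) (integral_nonneg fun ω => by positivity)
  have h' := Real.rpow_le_rpow (Real.rpow_nonneg h0 (1 / γ)) h hγ.le
  rwa [← Real.rpow_mul h0, one_div_mul_cancel hγ.ne', Real.rpow_one] at h'

lemma sqHellinger_le_of_le_two {γ δ : ℝ} (h1 : 1 ≤ γ) (h2 : γ ≤ 2) [IsFiniteMeasure P]
    [IsFiniteMeasure Q] (h : genHellinger γ P Q ≤ δ) : sqHellinger P Q ≤ δ ^ γ := by
  refine le_trans ?_ (half_integral_le_of_genHellinger_le h1 h)
  refine mul_le_mul_of_nonneg_left ?_ (by norm_num)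
  exact integral_mono integrable_sq_sqrt_rnDeriv_sub (integrable_abs_rpow_rnDeriv_sub h1)
    fun ω => sq_sqrt_sub_sqrt_le_of_le_two h1 h2 ENNReal.toReal_nonneg ENNReal.toReal_nonneg

/-- For `γ > 2` the squared Hellinger distance is controlled by Hölder's inequality with exponents
`γ / 2` and `γ / (γ - 2)`. -/
lemma sqHellinger_le_of_two_lt {γ δ : ℝ} (h2 : 2 < γ) (hδ : 0 ≤ δ) [IsProbabilityMeasure P]
    [IsProbabilityMeasure Q] (h : genHellinger γ P Q ≤ δ) :
    sqHellinger P Q ≤ γ ^ 2 / 4 * δ ^ 2 := by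
  have hγ : 0 < γ := by linarith
  have hγ2 : 0 < γ - 2 := by linarith
  have hint := integrable_abs_rpow_rnDeriv_sub (P := P) (Q := Q) (γ := γ) (by linarith)
  have hI := half_integral_le_of_genHellinger_le (P := P) (Q := Q) (by linarith) h
  have hsum := integrable_toReal_rnDeriv_add (P := P) (Q := Q)
  have hsum2 := integral_toReal_rnDeriv_add (P := P) (Q := Q)
  unfold sqHellinger
  set p := fun ω => (P.rnDeriv (P + Q) ω).toReal with hp
  set q := fun ω => (Q.rnDeriv (P + Q) ω).toReal with hq
  have hp0 : ∀ ω, 0 ≤ p ω := fun _ => ENNReal.toReal_nonneg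
  have hq0 : ∀ ω, 0 ≤ q ω := fun _ => ENNReal.toReal_nonneg
  have hpm : Measurable p := by fun_prop
  have hqm : Measurable q := by fun_prop
  have hpq : (γ / 2).HolderConjugate (γ / (γ - 2)) := by
    rw [Real.holderConjugate_iff]
    exact ⟨by linarith, by field_simp; ring⟩
  set F : Ω → ℝ := fun ω => |p ω ^ (1 / γ) - q ω ^ (1 / γ)| ^ 2 with hF
  set G : Ω → ℝ := fun ω => (p ω + q ω) ^ ((γ - 2) / γ) with hG
  have hF0 : ∀ ω, 0 ≤ F ω := fun ω => by positivity
  have hG0 : ∀ ω, 0 ≤ G ω := fun ω => Real.rpow_nonneg (add_nonneg (hp0 ω) (hq0 ω)) _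
  have hFp : ∀ ω, F ω ^ (γ / 2) = |p ω ^ (1 / γ) - q ω ^ (1 / γ)| ^ γ := fun ω => by
    simp only [hF]
    rw [← Real.rpow_natCast, ← Real.rpow_mul (abs_nonneg _)]; congr 1; push_cast; ring
  have hGp : ∀ ω, G ω ^ (γ / (γ - 2)) = p ω + q ω := fun ω => by
    simp only [hG]
    rw [← Real.rpow_mul (add_nonneg (hp0 ω) (hq0 ω))]
    rw [show (γ - 2) / γ * (γ / (γ - 2)) = 1 by field_simp, Real.rpow_one]
  have memF : MemLp F (ENNReal.ofReal (γ / 2)) (P + Q) := by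
    rw [← integrable_norm_rpow_iff (Measurable.aestronglyMeasurable (by fun_prop))
      (by simpa using hγ) (by simp), ENNReal.toReal_ofReal (by positivity)]
    simpa only [Real.norm_of_nonneg (hF0 _), hFp] using hint
  have memG : MemLp G (ENNReal.ofReal (γ / (γ - 2))) (P + Q) := by
    rw [← integrable_norm_rpow_iff (Measurable.aestronglyMeasurable (by fun_prop))
      (by simpa using by positivity) (by simp), ENNReal.toReal_ofReal (by positivity)]
    simpa only [Real.norm_of_nonneg (hG0 _), hGp] using hsum
  have hol := integral_mul_le_Lp_mul_Lq_of_nonneg hpq (Filter.Eventually.of_forall hF0)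
    (Filter.Eventually.of_forall hG0) memF memG
  simp only [hFp, hGp] at hol
  rw [hsum2] at hol
  have hFG : Integrable (fun ω => F ω * G ω) (P + Q) := by
    have : ENNReal.HolderConjugate (ENNReal.ofReal (γ / 2)) (ENNReal.ofReal (γ / (γ - 2))) :=
      Real.HolderConjugate.ennrealOfReal hpq
    exact memF.integrable_mul memG
  set I := ∫ ω, |p ω ^ (1 / γ) - q ω ^ (1 / γ)| ^ γ ∂(P + Q) with hIdef
  have hI0 : 0 ≤ I := integral_nonneg fun ω => by positivity
  have hI2 : I ^ (1 / (γ / 2)) ≤ 2 ^ (2 / γ) * δ ^ 2 := by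
    calc I ^ (1 / (γ / 2)) ≤ (2 * δ ^ γ) ^ (1 / (γ / 2)) :=
          Real.rpow_le_rpow hI0 (by linarith) (by positivity)
      _ = 2 ^ (2 / γ) * δ ^ 2 := by
          rw [Real.mul_rpow (by norm_num) (by positivity), ← Real.rpow_mul hδ,
            ← Real.rpow_natCast δ 2]
          congr 2
          · field_simp
          · push_cast; field_simp
  have htwo : (2 : ℝ) ^ (2 / γ) * 2 ^ (1 / (γ / (γ - 2))) = 2 := by
    rw [← Real.rpow_add (by norm_num)]
    rw [show 2 / γ + 1 / (γ / (γ - 2)) = 1 by field_simp; ring, Real.rpow_one]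
  have hmain : ∫ ω, (√(p ω) - √(q ω)) ^ 2 ∂(P + Q) ≤ γ ^ 2 / 4 * (2 * δ ^ 2) := by
    calc ∫ ω, (√(p ω) - √(q ω)) ^ 2 ∂(P + Q) ≤ ∫ ω, γ ^ 2 / 4 * (F ω * G ω) ∂(P + Q) :=
          integral_mono integrable_sq_sqrt_rnDeriv_sub (hFG.const_mul _)
            fun ω => sq_sqrt_sub_sqrt_le_of_two_lt h2 (hp0 ω) (hq0 ω)
      _ = γ ^ 2 / 4 * ∫ ω, F ω * G ω ∂(P + Q) := integral_const_mul _ _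
      _ ≤ γ ^ 2 / 4 * (2 * δ ^ 2) := by
          gcongr
          calc _ ≤ _ := hol
            _ ≤ (2 ^ (2 / γ) * δ ^ 2) * 2 ^ (1 / (γ / (γ - 2))) := by gcongr
            _ = 2 * δ ^ 2 := by rw [mul_right_comm, htwo]
  linarith

end Hellinger

/-! ### A variational bound and its stability under mixtures -/

section Variational

/-- The variational form of a bound on the triangular discrimination `∫ (p - q)² / (p + q) dμ`: the
inequality `∫ θ dP - ∫ θ dQ ≤ c + ½ (∫ θ² dP + ∫ θ² dQ)` for every measurable `θ` with values in
`[-1, 1]`. Unlike the integral itself, it involves no densities, so that it passes to mixtures of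
families of measures which have no common dominating measure. -/
def VarBound {Ω : Type*} [MeasurableSpace Ω] (c : ℝ) (P Q : Measure Ω) : Prop :=
  ∀ θ : Ω → ℝ, Measurable θ → (∀ ω, |θ ω| ≤ 1) →
    ∫ ω, θ ω ∂P - ∫ ω, θ ω ∂Q ≤ c + (1 / 2) * (∫ ω, θ ω ^ 2 ∂P + ∫ ω, θ ω ^ 2 ∂Q)

lemma integrable_of_abs_le_one {Ω : Type*} [MeasurableSpace Ω] {P : Measure Ω} [IsFiniteMeasure P]
    {θ : Ω → ℝ} (hθ : Measurable θ) (h1 : ∀ ω, |θ ω| ≤ 1) : Integrable θ P :=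
  Integrable.of_bound hθ.aestronglyMeasurable 1 (Filter.Eventually.of_forall h1)

lemma abs_sq_le_one {a : ℝ} (h : |a| ≤ 1) : |a ^ 2| ≤ 1 := by
  rw [abs_pow]; exact pow_le_one₀ (abs_nonneg _) h

lemma VarBound.map {Ω Ω' : Type*} [MeasurableSpace Ω] [MeasurableSpace Ω'] {c : ℝ}
    {P Q : Measure Ω} (h : VarBound c P Q) {g : Ω → Ω'} (hg : Measurable g) :
    VarBound c (P.map g) (Q.map g) := by
  intro θ hθ h1
  rw [integral_map hg.aemeasurable hθ.aestronglyMeasurable,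
    integral_map hg.aemeasurable hθ.aestronglyMeasurable,
    integral_map hg.aemeasurable (hθ.pow_const 2).aestronglyMeasurable,
    integral_map hg.aemeasurable (hθ.pow_const 2).aestronglyMeasurable]
  exact h _ (hθ.comp hg) fun ω => h1 _

lemma VarBound.sum_smul {Ω ι : Type*} [MeasurableSpace Ω] [Fintype ι] {c : ℝ}
    {P Q : ι → Measure Ω} [∀ i, IsFiniteMeasure (P i)] [∀ i, IsFiniteMeasure (Q i)]
    {w : ι → ENNReal} (hw : ∑ i, w i = 1) (h : ∀ i, w i ≠ 0 → VarBound c (P i) (Q i)) :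
    VarBound c (∑ i, w i • P i) (∑ i, w i • Q i) := by
  have hwt : ∀ i, w i ≠ ⊤ := fun i hi => by
    have : w i ≤ 1 := hw ▸ Finset.single_le_sum (fun _ _ => zero_le) (Finset.mem_univ i)
    simp [hi] at this
  have hw1 : ∑ i, (w i).toReal = 1 := by
    rw [← ENNReal.toReal_sum fun i _ => hwt i, hw]; simp
  intro θ hθ h1
  have key : ∀ (R : ι → Measure Ω) [∀ i, IsFiniteMeasure (R i)] (ψ : Ω → ℝ), Measurable ψ →
      (∀ ω, |ψ ω| ≤ 1) → ∫ ω, ψ ω ∂(∑ i, w i • R i) = ∑ i, (w i).toReal * ∫ ω, ψ ω ∂(R i) := by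
    intro R _ ψ hψ hψ1
    rw [integral_finsetSum_measure]
    · simp [integral_smul_measure]
    · exact fun i _ => (integrable_of_abs_le_one hψ hψ1).smul_measure (hwt i)
  have h2 : ∀ ω, |θ ω ^ 2| ≤ 1 := fun ω => abs_sq_le_one (h1 ω)
  rw [key P θ hθ h1, key Q θ hθ h1, key P _ (hθ.pow_const 2) h2, key Q _ (hθ.pow_const 2) h2,
    ← Finset.sum_sub_distrib, ← Finset.sum_add_distrib, Finset.mul_sum]
  have hc : c = ∑ i, (w i).toReal * c := by rw [← Finset.sum_mul, hw1, one_mul]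
  rw [hc, ← Finset.sum_add_distrib]
  refine Finset.sum_le_sum fun i _ => ?_
  by_cases hi : w i = 0
  · simp [hi]
  · have := mul_le_mul_of_nonneg_left (h i hi θ hθ h1) (ENNReal.toReal_nonneg (a := w i))
    linarith

/-- The maximizing test function `(p - q) / (p + q)` turns the variational bound into a bound on
the triangular discrimination, which dominates the squared Hellinger distance. -/
lemma VarBound.sqHellinger_le {Ω : Type*} [MeasurableSpace Ω] {c : ℝ} {P Q : Measure Ω}
    [IsFiniteMeasure P] [IsFiniteMeasure Q] (h : VarBound c P Q) : sqHellinger P Q ≤ c := by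
  have hP : P ≪ P + Q := Measure.AbsolutelyContinuous.rfl.add_right Q
  have hQ : Q ≪ P + Q := by rw [add_comm]; exact Measure.AbsolutelyContinuous.rfl.add_right P
  unfold sqHellinger
  have hint := integrable_sq_sqrt_rnDeriv_sub (P := P) (Q := Q)
  set p := fun ω => (P.rnDeriv (P + Q) ω).toReal with hp
  set q := fun ω => (Q.rnDeriv (P + Q) ω).toReal with hq
  have hp0 : ∀ ω, 0 ≤ p ω := fun _ => ENNReal.toReal_nonneg
  have hq0 : ∀ ω, 0 ≤ q ω := fun _ => ENNReal.toReal_nonneg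
  set θ : Ω → ℝ := fun ω => (p ω - q ω) / (p ω + q ω) with hθdef
  have hθ : Measurable θ := by fun_prop
  have h1 : ∀ ω, |θ ω| ≤ 1 := fun ω => by
    rw [hθdef, abs_div, abs_of_nonneg (add_nonneg (hp0 ω) (hq0 ω))]
    refine div_le_one_of_le₀ ?_ (add_nonneg (hp0 ω) (hq0 ω))
    rw [abs_le]; constructor <;> linarith [hp0 ω, hq0 ω]
  have h2 : ∀ ω, |θ ω ^ 2| ≤ 1 := fun ω => abs_sq_le_one (h1 ω)
  have hb := h θ hθ h1
  have key : ∀ ν : Measure Ω, IsFiniteMeasure ν → ν ≪ P + Q → ∀ ψ : Ω → ℝ, Measurable ψ →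
      (∀ ω, |ψ ω| ≤ 1) → Integrable (fun ω => (ν.rnDeriv (P + Q) ω).toReal * ψ ω) (P + Q) ∧
        (∫ ω, ψ ω ∂ν) = ∫ ω, (ν.rnDeriv (P + Q) ω).toReal * ψ ω ∂(P + Q) := fun ν _ hR ψ hψ hψ1 =>
    ⟨(integrable_rnDeriv_smul_iff hR).2 (integrable_of_abs_le_one hψ hψ1),
      (integral_rnDeriv_smul hR).symm⟩
  obtain ⟨iP, eP⟩ := key P inferInstance hP θ hθ h1
  obtain ⟨iQ, eQ⟩ := key Q inferInstance hQ θ hθ h1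
  obtain ⟨iP2, eP2⟩ := key P inferInstance hP _ (hθ.pow_const 2) h2
  obtain ⟨iQ2, eQ2⟩ := key Q inferInstance hQ _ (hθ.pow_const 2) h2
  rw [eP, eQ, eP2, eQ2, ← integral_sub iP iQ, ← integral_add iP2 iQ2] at hb
  have e1 : ∀ ω, p ω * θ ω - q ω * θ ω = p ω * θ ω ^ 2 + q ω * θ ω ^ 2 := fun ω => by
    rcases (add_nonneg (hp0 ω) (hq0 ω)).eq_or_lt with h0 | h0
    · simp [hθdef, ← h0]
    · simp only [hθdef]; field_simp
  have e2 : ∫ ω, (p ω * θ ω - q ω * θ ω) ∂(P + Q)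
      = ∫ ω, (p ω * θ ω ^ 2 + q ω * θ ω ^ 2) ∂(P + Q) := integral_congr_ae
        (Filter.Eventually.of_forall e1)
  have e3 : ∫ ω, (√(p ω) - √(q ω)) ^ 2 ∂(P + Q)
      ≤ ∫ ω, (p ω * θ ω ^ 2 + q ω * θ ω ^ 2) ∂(P + Q) := by
    refine integral_mono hint (iP2.add iQ2) fun ω => ?_
    change (√(p ω) - √(q ω)) ^ 2 ≤ p ω * θ ω ^ 2 + q ω * θ ω ^ 2
    rcases (add_nonneg (hp0 ω) (hq0 ω)).eq_or_lt with h0 | h0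
    · have hp' : p ω = 0 := by linarith [hp0 ω, hq0 ω]
      have hq' : q ω = 0 := by linarith [hp0 ω, hq0 ω]
      simp [hp', hq']
    · have e : p ω * θ ω ^ 2 + q ω * θ ω ^ 2 = (p ω - q ω) ^ 2 / (p ω + q ω) := by
        simp only [hθdef]; field_simp
      rw [e, le_div_iff₀ h0]
      have hp' := Real.sq_sqrt (hp0 ω)
      have hq' := Real.sq_sqrt (hq0 ω)
      have hpos := mul_nonneg (Real.sqrt_nonneg (p ω)) (Real.sqrt_nonneg (q ω))
      generalize √(p ω) = a at *
      generalize √(q ω) = b at *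
      rw [← hp', ← hq', show a ^ 2 - b ^ 2 = (a - b) * (a + b) by ring, mul_pow]
      exact mul_le_mul_of_nonneg_left (by nlinarith) (sq_nonneg _)
  have hb' : ∫ ω, (p ω * θ ω - q ω * θ ω) ∂(P + Q)
      ≤ c + 1 / 2 * ∫ ω, (p ω * θ ω ^ 2 + q ω * θ ω ^ 2) ∂(P + Q) := hb
  linarith

end Variational

/-! ### Mixtures of product measures and products of mixtures -/

section Mixture

lemma exists_nnreal_density {Ω : Type*} [MeasurableSpace Ω] {P μ : Measure Ω} [IsFiniteMeasure P]
    [IsFiniteMeasure μ] (h : P ≪ μ) :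
    ∃ f : Ω → NNReal, Measurable f ∧ (∀ ω, (f ω : ℝ) = (P.rnDeriv μ ω).toReal) ∧
      P = μ.withDensity fun ω => (f ω : ENNReal) := by
  refine ⟨fun ω => (P.rnDeriv μ ω).toNNReal, by fun_prop, fun ω => rfl, ?_⟩
  conv_lhs => rw [← Measure.withDensity_rnDeriv_eq P μ h]
  refine withDensity_congr_ae ?_
  filter_upwards [Measure.rnDeriv_ne_top P μ] with ω hω
  exact (ENNReal.coe_toNNReal hω).symm

variable {𝒳 𝒴 𝒵 : Type*} [MeasurableSpace 𝒳] [MeasurableSpace 𝒴] [MeasurableSpace 𝒵]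

lemma integral_prod_eq_integral_rnDeriv_mul {P μ : Measure 𝒳} {Q ν : Measure 𝒴} [IsFiniteMeasure P]
    [IsFiniteMeasure μ] [IsFiniteMeasure Q] [IsFiniteMeasure ν] (hP : P ≪ μ) (hQ : Q ≪ ν)
    {θ : 𝒳 × 𝒴 → ℝ} (hθ : Integrable θ (P.prod Q)) :
    Integrable (fun z => (P.rnDeriv μ z.1).toReal * (Q.rnDeriv ν z.2).toReal * θ z) (μ.prod ν) ∧
      ∫ z, (P.rnDeriv μ z.1).toReal * (Q.rnDeriv ν z.2).toReal * θ z ∂(μ.prod ν)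
        = ∫ z, θ z ∂(P.prod Q) := by
  obtain ⟨f, hf, hfe, hPf⟩ := exists_nnreal_density hP
  obtain ⟨g, hg, hge, hQg⟩ := exists_nnreal_density hQ
  have hfg : Measurable fun z : 𝒳 × 𝒴 => f z.1 * g z.2 := by fun_prop
  have e : P.prod Q = (μ.prod ν).withDensity fun z => ((f z.1 * g z.2 : NNReal) : ENNReal) := by
    conv_lhs => rw [hPf, hQg]
    rw [prod_withDensity (by fun_prop) (by fun_prop)]
    simp
  simp only [← hfe, ← hge]
  constructor
  · rw [e, integrable_withDensity_iff_integrable_smul hfg] at hθ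
    simpa [NNReal.smul_def] using hθ
  · rw [e, integral_withDensity_eq_integral_smul hfg]
    simp [NNReal.smul_def]

/-- The inequality `x y ≤ 2 x² + y² / 8` for `x = (√a - √a') (√b - √b')` and
`y = t (√a + √a') (√b + √b')`, where `y² ≤ 4 t² (a + a') (b + b')`. -/
lemma mul_sub_mul_sub_le {a a' b b' : ℝ} (ha : 0 ≤ a) (ha' : 0 ≤ a') (hb : 0 ≤ b) (hb' : 0 ≤ b')
    (t : ℝ) : t * ((a - a') * (b - b')) ≤
      2 * ((√a - √a') ^ 2 * (√b - √b') ^ 2) + 1 / 2 * (t ^ 2 * ((a + a') * (b + b'))) := by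
  have h1 := Real.sq_sqrt ha
  have h2 := Real.sq_sqrt ha'
  have h3 := Real.sq_sqrt hb
  have h4 := Real.sq_sqrt hb'
  generalize √a = u at *
  generalize √a' = u' at *
  generalize √b = v at *
  generalize √b' = v' at *
  subst h1 h2 h3 h4
  have hU : (u + u') ^ 2 ≤ 2 * (u ^ 2 + u' ^ 2) := by nlinarith [sq_nonneg (u - u')]
  have hV : (v + v') ^ 2 ≤ 2 * (v ^ 2 + v' ^ 2) := by nlinarith [sq_nonneg (v - v')]
  have hUV := mul_le_mul hU hV (sq_nonneg _) (by positivity)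
  have hUVt := mul_le_mul_of_nonneg_left hUV (sq_nonneg t)
  nlinarith [sq_nonneg (4 * ((u - u') * (v - v')) - t * ((u + u') * (v + v')))]

/-- The mixed second difference of the product measures `P ⊗ Q` is of second order: it is bounded
by the product of two squared Hellinger distances. -/
lemma integral_prod_second_difference_le {P P' : Measure 𝒳} {Q Q' : Measure 𝒴}
    [IsFiniteMeasure P] [IsFiniteMeasure P'] [IsFiniteMeasure Q] [IsFiniteMeasure Q'] {ε : ℝ}
    (hε : 0 ≤ ε) (hP : sqHellinger P P' ≤ ε) (hQ : sqHellinger Q Q' ≤ ε) {θ : 𝒳 × 𝒴 → ℝ}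
    (hθ : Measurable θ) (h1 : ∀ z, |θ z| ≤ 1) :
    ∫ z, θ z ∂(P.prod Q) + ∫ z, θ z ∂(P'.prod Q')
        - (∫ z, θ z ∂(P.prod Q') + ∫ z, θ z ∂(P'.prod Q)) ≤
      8 * ε ^ 2 + 1 / 2 * (∫ z, θ z ^ 2 ∂(P.prod Q) + ∫ z, θ z ^ 2 ∂(P'.prod Q')
        + (∫ z, θ z ^ 2 ∂(P.prod Q') + ∫ z, θ z ^ 2 ∂(P'.prod Q))) := by
  have aP : P ≪ P + P' := Measure.AbsolutelyContinuous.rfl.add_right P'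
  have aP' : P' ≪ P + P' := by rw [add_comm]; exact Measure.AbsolutelyContinuous.rfl.add_right P
  have aQ : Q ≪ Q + Q' := Measure.AbsolutelyContinuous.rfl.add_right Q'
  have aQ' : Q' ≪ Q + Q' := by rw [add_comm]; exact Measure.AbsolutelyContinuous.rfl.add_right Q
  have hθ2 := hθ.pow_const 2
  have h2 : ∀ z, |θ z ^ 2| ≤ 1 := fun z => abs_sq_le_one (h1 z)
  obtain ⟨i1, e1⟩ := integral_prod_eq_integral_rnDeriv_mul aP aQ (integrable_of_abs_le_one hθ h1)
  obtain ⟨i2, e2⟩ := integral_prod_eq_integral_rnDeriv_mul aP' aQ' (integrable_of_abs_le_one hθ h1)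
  obtain ⟨i3, e3⟩ := integral_prod_eq_integral_rnDeriv_mul aP aQ' (integrable_of_abs_le_one hθ h1)
  obtain ⟨i4, e4⟩ := integral_prod_eq_integral_rnDeriv_mul aP' aQ (integrable_of_abs_le_one hθ h1)
  obtain ⟨j1, f1⟩ := integral_prod_eq_integral_rnDeriv_mul aP aQ (integrable_of_abs_le_one hθ2 h2)
  obtain ⟨j2, f2⟩ :=
    integral_prod_eq_integral_rnDeriv_mul aP' aQ' (integrable_of_abs_le_one hθ2 h2)
  obtain ⟨j3, f3⟩ := integral_prod_eq_integral_rnDeriv_mul aP aQ' (integrable_of_abs_le_one hθ2 h2)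
  obtain ⟨j4, f4⟩ := integral_prod_eq_integral_rnDeriv_mul aP' aQ (integrable_of_abs_le_one hθ2 h2)
  have k1 := integrable_sq_sqrt_rnDeriv_sub (P := P) (Q := P')
  have k2 := integrable_sq_sqrt_rnDeriv_sub (P := Q) (Q := Q')
  have k3 := k1.mul_prod k2
  have g3 := integral_prod_mul (μ := P + P') (ν := Q + Q')
    (fun x => (√(P.rnDeriv (P + P') x).toReal - √(P'.rnDeriv (P + P') x).toReal) ^ 2)
    (fun y => (√(Q.rnDeriv (Q + Q') y).toReal - √(Q'.rnDeriv (Q + Q') y).toReal) ^ 2)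
  have n1 : 0 ≤ ∫ x, (√(P.rnDeriv (P + P') x).toReal - √(P'.rnDeriv (P + P') x).toReal) ^ 2
    ∂(P + P') := integral_nonneg fun _ => sq_nonneg _
  have n2 : 0 ≤ ∫ x, (√(Q.rnDeriv (Q + Q') x).toReal - √(Q'.rnDeriv (Q + Q') x).toReal) ^ 2
    ∂(Q + Q') := integral_nonneg fun _ => sq_nonneg _
  have b3 : ∫ z : 𝒳 × 𝒴,
      (√(P.rnDeriv (P + P') z.1).toReal - √(P'.rnDeriv (P + P') z.1).toReal) ^ 2 *
        (√(Q.rnDeriv (Q + Q') z.2).toReal - √(Q'.rnDeriv (Q + Q') z.2).toReal) ^ 2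
          ∂((P + P').prod (Q + Q')) ≤ (2 * ε) * (2 * ε) := by
    rw [g3]
    unfold sqHellinger at hP hQ
    exact mul_le_mul (by linarith) (by linarith) n2 (by linarith)
  have hmono := integral_mono ((i1.add i2).sub (i3.add i4))
    ((k3.const_mul 2).add (((j1.add j2).add (j3.add j4)).const_mul (1 / 2))) fun z => by
      have := mul_sub_mul_sub_le (ENNReal.toReal_nonneg (a := P.rnDeriv (P + P') z.1))
        (ENNReal.toReal_nonneg (a := P'.rnDeriv (P + P') z.1))
        (ENNReal.toReal_nonneg (a := Q.rnDeriv (Q + Q') z.2))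
        (ENNReal.toReal_nonneg (a := Q'.rnDeriv (Q + Q') z.2)) (θ z)
      simp only [Pi.add_apply, Pi.sub_apply]
      linarith
  rw [integral_sub' (i1.add i2) (i3.add i4), integral_add' i1 i2, integral_add' i3 i4,
    integral_add' (k3.const_mul 2) (((j1.add j2).add (j3.add j4)).const_mul (1 / 2)),
    integral_const_mul, integral_const_mul, integral_add' (j1.add j2) (j3.add j4),
    integral_add' j1 j2, integral_add' j3 j4, e1, e2, e3, e4, f1, f2, f3, f4] at hmono
  linarith

lemma integral_comp_measure {κ : Kernel 𝒵 𝒳} {ρ : Measure 𝒵} {θ : 𝒳 → ℝ}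
    (hθ : Integrable θ (κ ∘ₘ ρ)) : ∫ x, θ x ∂(κ ∘ₘ ρ) = ∫ z, ∫ x, θ x ∂(κ z) ∂ρ := by
  rw [Measure.comp_eq_comp_const_apply] at hθ ⊢
  rw [Kernel.integral_comp hθ, Kernel.const_apply]

lemma prod_comp_eq_parallelComp_comp {κ : Kernel 𝒵 𝒳} {η : Kernel 𝒵 𝒴} [IsMarkovKernel κ]
    [IsMarkovKernel η] {ρ : Measure 𝒵} [IsFiniteMeasure ρ] :
    (κ ∘ₘ ρ).prod (η ∘ₘ ρ) = (κ ∥ₖ η) ∘ₘ (ρ.prod ρ) := by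
  rw [Measure.prod_comp_left, Measure.prod_comp_right, Measure.comp_assoc,
    Kernel.parallelComp_comp_parallelComp, Kernel.comp_id, Kernel.id_comp]

lemma integral_symmetrized {ρ : Measure 𝒵} [IsProbabilityMeasure ρ] {g : 𝒵 × 𝒵 → ℝ}
    (hg : Measurable g) (h1 : ∀ p, |g p| ≤ 1) (s : ℝ) :
    Integrable (fun p => g (p.1, p.1) + g (p.2, p.2) + s * (g p + g p.swap)) (ρ.prod ρ) ∧
    ∫ p, (g (p.1, p.1) + g (p.2, p.2) + s * (g p + g p.swap)) ∂(ρ.prod ρ)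
      = 2 * (∫ z, g (z, z) ∂ρ + s * ∫ p, g p ∂(ρ.prod ρ)) := by
  have i1 : Integrable (fun p : 𝒵 × 𝒵 => g (p.1, p.1)) (ρ.prod ρ) :=
    integrable_of_abs_le_one (by fun_prop) fun _ => h1 _
  have i2 : Integrable (fun p : 𝒵 × 𝒵 => g (p.2, p.2)) (ρ.prod ρ) :=
    integrable_of_abs_le_one (by fun_prop) fun _ => h1 _
  have i3 : Integrable g (ρ.prod ρ) := integrable_of_abs_le_one hg h1
  have i4 : Integrable (fun p => g p.swap) (ρ.prod ρ) :=
    integrable_of_abs_le_one (by fun_prop) fun _ => h1 _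
  refine ⟨(i1.add i2).add ((i3.add i4).const_mul s), ?_⟩
  have e1 := integral_fun_fst (μ := ρ) (ν := ρ) (fun z => g (z, z))
  have e2 := integral_fun_snd (μ := ρ) (ν := ρ) (fun z => g (z, z))
  have e4 := integral_prod_swap (μ := ρ) (ν := ρ) g
  simp only [probReal_univ, one_smul] at e1 e2
  have i34 : Integrable (fun p => s * (g p + g p.swap)) (ρ.prod ρ) := (i3.add i4).const_mul s
  have i12 : Integrable (fun p : 𝒵 × 𝒵 => g (p.1, p.1) + g (p.2, p.2)) (ρ.prod ρ) := i1.add i2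
  rw [integral_add i12 i34, integral_add i1 i2, integral_const_mul, integral_add i3 i4,
    e1, e2, e4]
  ring

/-- If the kernels vary by at most `ε` in squared Hellinger distance over a set of full
`ρ`-measure, the mixture of the products `κ z ⊗ η z` and the product of the two mixtures satisfy a
variational bound of order `ε²`: their difference is the average of the mixed second differences of
`κ z ⊗ η z'` over two independent draws `z, z'` from `ρ`. -/
lemma varBound_mixture {κ : Kernel 𝒵 𝒳} {η : Kernel 𝒵 𝒴} [IsMarkovKernel κ] [IsMarkovKernel η]
    {ρ : Measure 𝒵} [IsProbabilityMeasure ρ] {T : Set 𝒵} (hT : ∀ᵐ z ∂ρ, z ∈ T) {ε : ℝ}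
    (hε : 0 ≤ ε) (hκ : ∀ z ∈ T, ∀ z' ∈ T, sqHellinger (κ z) (κ z') ≤ ε)
    (hη : ∀ z ∈ T, ∀ z' ∈ T, sqHellinger (η z) (η z') ≤ ε) :
    VarBound (4 * ε ^ 2) ((κ ×ₖ η) ∘ₘ ρ) ((κ ∘ₘ ρ).prod (η ∘ₘ ρ)) := by
  intro θ hθ h1
  have hθ2 := hθ.pow_const 2
  have h2 : ∀ z, |θ z ^ 2| ≤ 1 := fun z => abs_sq_le_one (h1 z)
  let g : (𝒳 × 𝒴 → ℝ) → 𝒵 × 𝒵 → ℝ := fun ψ p => ∫ w, ψ w ∂((κ ∥ₖ η) p)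
  have hgapply : ∀ ψ p, g ψ p = ∫ w, ψ w ∂((κ p.1).prod (η p.2)) := fun ψ p => by
    simp only [g, Kernel.parallelComp_apply]
  have hgm : ∀ ψ : 𝒳 × 𝒴 → ℝ, Measurable ψ → Measurable (g ψ) := fun ψ hψ =>
    (StronglyMeasurable.integral_kernel hψ.stronglyMeasurable).measurable
  have hg1 : ∀ ψ : 𝒳 × 𝒴 → ℝ, (∀ w, |ψ w| ≤ 1) → ∀ p, |g ψ p| ≤ 1 := fun ψ hψ p => by
    have := norm_integral_le_of_norm_le_const (μ := (κ ∥ₖ η) p) (f := ψ) (C := 1)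
      (Filter.Eventually.of_forall hψ)
    simpa using this
  have eP : ∀ ψ : 𝒳 × 𝒴 → ℝ, Measurable ψ → (∀ w, |ψ w| ≤ 1) →
      (∫ w, ψ w ∂((κ ×ₖ η) ∘ₘ ρ)) = ∫ z, g ψ (z, z) ∂ρ := fun ψ hψ hψ1 => by
    rw [integral_comp_measure (integrable_of_abs_le_one hψ hψ1)]
    simp only [hgapply, Kernel.prod_apply]
  have eQ : ∀ ψ : 𝒳 × 𝒴 → ℝ, Measurable ψ → (∀ w, |ψ w| ≤ 1) →
      (∫ w, ψ w ∂((κ ∘ₘ ρ).prod (η ∘ₘ ρ))) = ∫ p, g ψ p ∂(ρ.prod ρ) := fun ψ hψ hψ1 => by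
    rw [prod_comp_eq_parallelComp_comp,
      integral_comp_measure (integrable_of_abs_le_one hψ hψ1)]
  obtain ⟨i1, e1⟩ := integral_symmetrized (ρ := ρ) (hgm θ hθ) (hg1 θ h1) (-1)
  obtain ⟨i2, e2⟩ := integral_symmetrized (ρ := ρ) (hgm _ hθ2) (hg1 _ h2) 1
  have hTT : ∀ᵐ p ∂(ρ.prod ρ), p.1 ∈ T ∧ p.2 ∈ T := by
    have q1 := Measure.quasiMeasurePreserving_fst (μ := ρ) (ν := ρ)
    have q2 := Measure.quasiMeasurePreserving_snd (μ := ρ) (ν := ρ)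
    filter_upwards [q1.ae hT, q2.ae hT] with p hp hp'
    exact ⟨hp, hp'⟩
  have i3 := i2.const_mul (1 / 2)
  have hmono := integral_mono_ae i1 ((integrable_const (8 * ε ^ 2)).add i3) (by
    filter_upwards [hTT] with p hp
    have := integral_prod_second_difference_le hε (hκ _ hp.1 _ hp.2) (hη _ hp.1 _ hp.2) hθ h1
    simp only [hgapply, Pi.add_apply, Prod.fst_swap, Prod.snd_swap]
    linarith)
  rw [integral_add' (integrable_const _) i3, integral_const, probReal_univ, one_smul,
    integral_const_mul, e1, e2, ← eP θ hθ h1, ← eQ θ hθ h1, ← eP _ hθ2 h2,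
    ← eQ _ hθ2 h2] at hmono
  linarith

end Mixture

/-! ### Total variation bound for product measures -/

section Tensorization

variable {Ω : Type*} [MeasurableSpace Ω]

lemma lintegral_pi_prod {n : ℕ} {μ : Fin n → Measure Ω} [∀ i, SigmaFinite (μ i)]
    {f : Fin n → Ω → ENNReal} (hf : ∀ i, Measurable (f i)) :
    ∫⁻ s, ∏ i, f i (s i) ∂(Measure.pi μ) = ∏ i, ∫⁻ ω, f i ω ∂(μ i) := by
  induction n with
  | zero => simp
  | succ n ih =>
    have hmp := measurePreserving_piFinSuccAbove μ 0
    have hm : Measurable fun s : Fin n → Ω => ∏ i, f i.succ (s i) :=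
      Finset.measurable_prod _ fun i _ => (hf i.succ).comp (measurable_pi_apply i)
    rw [Fin.prod_univ_succ, ← ih fun i => hf i.succ]
    simp only [Fin.zero_succAbove] at hmp
    have hm' : Measurable fun z : Ω × (Fin n → Ω) => f 0 z.1 * ∏ i, f i.succ (z.2 i) :=
      ((hf 0).comp measurable_fst).mul (hm.comp measurable_snd)
    rw [← lintegral_prod_mul (hf 0).aemeasurable hm.aemeasurable, ← hmp.lintegral_comp hm']
    refine lintegral_congr fun s => ?_
    rw [Fin.prod_univ_succ]
    rfl

lemma pi_withDensity {μ : Measure Ω} [IsFiniteMeasure μ] {n : ℕ} {f : Ω → NNReal}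
    (hf : Measurable f) :
    (Measure.pi fun _ : Fin n => μ.withDensity fun ω => (f ω : ENNReal))
      = (Measure.pi fun _ : Fin n => μ).withDensity
          fun s => ((∏ i, f (s i) : NNReal) : ENNReal) := by
  refine Measure.pi_eq fun s hs => ?_
  rw [withDensity_apply _ (MeasurableSet.univ_pi hs), Measure.restrict_pi_pi]
  have h := fun i => withDensity_apply (μ := μ) (fun ω => (f ω : ENNReal)) (hs i)
  simp only [h]
  simp only [ENNReal.ofNNReal_finsetProd]
  exact lintegral_pi_prod fun _ => hf.coe_nnreal_ennreal

lemma integral_sqrt_mul_sqrt_rnDeriv {P Q : Measure Ω} [IsProbabilityMeasure P]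
    [IsProbabilityMeasure Q] :
    Integrable (fun ω => √(P.rnDeriv (P + Q) ω).toReal * √(Q.rnDeriv (P + Q) ω).toReal) (P + Q) ∧
    ∫ ω, √(P.rnDeriv (P + Q) ω).toReal * √(Q.rnDeriv (P + Q) ω).toReal ∂(P + Q)
      = 1 - sqHellinger P Q := by
  have i1 := integrable_toReal_rnDeriv_add (P := P) (Q := Q)
  have i2 := integrable_sq_sqrt_rnDeriv_sub (P := P) (Q := Q)
  have e : (fun ω => √(P.rnDeriv (P + Q) ω).toReal * √(Q.rnDeriv (P + Q) ω).toReal)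
      = fun ω => (1 / 2) * (((P.rnDeriv (P + Q) ω).toReal + (Q.rnDeriv (P + Q) ω).toReal)
        - (√(P.rnDeriv (P + Q) ω).toReal - √(Q.rnDeriv (P + Q) ω).toReal) ^ 2) := by
    funext ω
    have h1 := Real.sq_sqrt (ENNReal.toReal_nonneg (a := P.rnDeriv (P + Q) ω))
    have h2 := Real.sq_sqrt (ENNReal.toReal_nonneg (a := Q.rnDeriv (P + Q) ω))
    linear_combination (1 / 2 : ℝ) * h1 + 1 / 2 * h2
  rw [e]
  refine ⟨(i1.sub i2).const_mul _, ?_⟩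
  rw [integral_const_mul, integral_sub i1 i2, integral_toReal_rnDeriv_add]
  unfold sqHellinger
  ring

/-- The inequality `|x² - y²| ≤ t (x - y)² / 2 + (x + y)² / (2 t)`, combined with
`(x + y)² ≤ 2 (x² + y²)` and expanded. For `x²`, `y²` probability densities, the right-hand side is
explicit in terms of the affinity `∫ x y`. -/
lemma mul_sq_sub_sq_le {x y t r : ℝ} (hx : 0 ≤ x) (hy : 0 ≤ y) (ht : 0 < t) (hr0 : 0 ≤ r)
    (hr1 : r ≤ 1) :
    r * x ^ 2 - r * y ^ 2 ≤ (t / 2 + 1 / t) * (x ^ 2 + y ^ 2) - t * (x * y) := by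
  have h1 : r * x ^ 2 - r * y ^ 2 ≤ |x - y| * (x + y) := by
    rw [show r * x ^ 2 - r * y ^ 2 = r * ((x - y) * (x + y)) by ring]
    have h := mul_le_mul_of_nonneg_right (le_abs_self (x - y)) (add_nonneg hx hy)
    have h' : 0 ≤ |x - y| * (x + y) := by positivity
    calc r * ((x - y) * (x + y)) ≤ r * (|x - y| * (x + y)) := by gcongr
      _ ≤ 1 * (|x - y| * (x + y)) := by gcongr
      _ = _ := one_mul _
  have h2 : |x - y| * (x + y) ≤ t / 2 * |x - y| ^ 2 + 1 / t * ((x + y) ^ 2 / 2) := by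
    have e : t / 2 * |x - y| ^ 2 + 1 / t * ((x + y) ^ 2 / 2) - |x - y| * (x + y)
        = (t * |x - y| - (x + y)) ^ 2 / (2 * t) := by field_simp; ring
    have : 0 ≤ (t * |x - y| - (x + y)) ^ 2 / (2 * t) := by positivity
    linarith
  have h3 : 1 / t * ((x + y) ^ 2 / 2) ≤ 1 / t * (x ^ 2 + y ^ 2) := by
    gcongr
    nlinarith [sq_nonneg (x - y)]
  rw [sq_abs] at h2
  nlinarith

/-- The Hellinger affinity `∫ √(p q)` is multiplicative over independent observations; Bernoulli's
inequality and `|p - q| = |√p - √q| (√p + √q)` then bound the difference of the expectations of a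
`[0, 1]`-valued function of `n` independent observations. -/
lemma integral_pi_sub_le {P Q : Measure Ω} [IsProbabilityMeasure P] [IsProbabilityMeasure Q]
    {c : ℝ} (hc : sqHellinger P Q ≤ c) {n : ℕ} {F : (Fin n → Ω) → ℝ} (hF : Measurable F)
    (hF0 : ∀ s, 0 ≤ F s) (hF1 : ∀ s, F s ≤ 1) :
    ∫ s, F s ∂(Measure.pi fun _ : Fin n => P) - ∫ s, F s ∂(Measure.pi fun _ : Fin n => Q)
      ≤ 3 * √(n * c) := by
  have hP : P ≪ P + Q := Measure.AbsolutelyContinuous.rfl.add_right Q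
  have hQ : Q ≪ P + Q := by rw [add_comm]; exact Measure.AbsolutelyContinuous.rfl.add_right P
  have hc0 : 0 ≤ sqHellinger P Q :=
    mul_nonneg (by norm_num) (integral_nonneg fun _ => sq_nonneg _)
  obtain ⟨iab, eab⟩ := integral_sqrt_mul_sqrt_rnDeriv (P := P) (Q := Q)
  have hc1 : sqHellinger P Q ≤ 1 := by
    have := integral_nonneg (μ := P + Q) (f := fun ω =>
      √(P.rnDeriv (P + Q) ω).toReal * √(Q.rnDeriv (P + Q) ω).toReal) fun ω => by positivity
    linarith
  obtain ⟨f, hf, hfe, hPf⟩ := exists_nnreal_density hP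
  obtain ⟨g, hg, hge, hQg⟩ := exists_nnreal_density hQ
  simp only [← hfe, ← hge] at iab eab
  generalize sqHellinger P Q = H at *
  set μn := Measure.pi fun _ : Fin n => P + Q
  have key : ∀ (ν : Measure Ω) [IsProbabilityMeasure ν] (k : Ω → NNReal), Measurable k →
      (ν = (P + Q).withDensity fun ω => (k ω : ENNReal)) →
      ∀ G : (Fin n → Ω) → ℝ, Measurable G → (∀ s, |G s| ≤ 1) →
        Integrable (fun s => G s * (∏ i, √(k (s i) : ℝ)) ^ 2) μn ∧
        ∫ s, G s * (∏ i, √(k (s i) : ℝ)) ^ 2 ∂μn = ∫ s, G s ∂(Measure.pi fun _ : Fin n => ν) := by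
    intro ν _ k hk hν G hG hG1
    have hpi : (Measure.pi fun _ : Fin n => ν)
        = μn.withDensity fun s => ((∏ i, k (s i) : NNReal) : ENNReal) := by
      conv_lhs => rw [hν]
      exact pi_withDensity hk
    have hkm : Measurable fun s : Fin n → Ω => ∏ i, k (s i) := by fun_prop
    have hint := integrable_of_abs_le_one (P := Measure.pi fun _ : Fin n => ν) hG hG1
    have e : (fun s : Fin n → Ω => G s * (∏ i, √(k (s i) : ℝ)) ^ 2)
        = fun s => (∏ i, k (s i)) • G s := by
      funext s
      rw [← Finset.prod_pow, NNReal.smul_def, NNReal.coe_prod, smul_eq_mul, mul_comm]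
      simp
    rw [e, hpi, integral_withDensity_eq_integral_smul hkm]
    rw [hpi, integrable_withDensity_iff_integrable_smul hkm] at hint
    exact ⟨hint, rfl⟩
  have hFabs : ∀ s, |F s| ≤ 1 := fun s => abs_le.2 ⟨by linarith [hF0 s], hF1 s⟩
  obtain ⟨iPF, ePF⟩ := key P f hf hPf F hF hFabs
  obtain ⟨iQF, eQF⟩ := key Q g hg hQg F hF hFabs
  obtain ⟨iA, eA⟩ := key P f hf hPf (fun _ => 1) measurable_const fun _ => by simp
  obtain ⟨iB, eB⟩ := key Q g hg hQg (fun _ => 1) measurable_const fun _ => by simp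
  simp only [one_mul, integral_const, probReal_univ, smul_eq_mul, mul_one] at iA iB eA eB
  have eAB : ∀ s : Fin n → Ω, (∏ i, √(f (s i) : ℝ)) * (∏ i, √(g (s i) : ℝ))
      = ∏ i, (√(f (s i) : ℝ) * √(g (s i) : ℝ)) := fun s => Finset.prod_mul_distrib.symm
  have iAB : Integrable (fun s => (∏ i, √(f (s i) : ℝ)) * (∏ i, √(g (s i) : ℝ))) μn := by
    simp only [eAB]
    exact Integrable.fintype_prod (f := fun _ ω => √(f ω : ℝ) * √(g ω : ℝ)) fun _ => iab
  have hAB : ∫ s, (∏ i, √(f (s i) : ℝ)) * (∏ i, √(g (s i) : ℝ)) ∂μn = (1 - H) ^ n := by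
    simp only [eAB]
    rw [integral_fintype_prod_eq_pow (fun ω => √(f ω : ℝ) * √(g ω : ℝ)), eab, Fintype.card_fin]
  have hbern : 1 - n * H ≤ (1 - H) ^ n := by
    have := one_add_mul_le_pow (a := -H) (by linarith) n
    rw [← sub_eq_add_neg] at this
    linarith
  have hbound : ∀ t : ℝ, 0 < t → ∫ s, F s ∂(Measure.pi fun _ : Fin n => P)
      - ∫ s, F s ∂(Measure.pi fun _ : Fin n => Q) ≤ t * (n * c) + 2 / t := by
    intro t ht
    have hm := integral_mono (iPF.sub iQF) (((iA.add iB).const_mul (t / 2 + 1 / t)).sub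
      (iAB.const_mul t)) fun s => mul_sq_sub_sq_le
        (Finset.prod_nonneg fun _ _ => Real.sqrt_nonneg _)
        (Finset.prod_nonneg fun _ _ => Real.sqrt_nonneg _) ht (hF0 s) (hF1 s)
    rw [integral_sub' iPF iQF, integral_sub' ((iA.add iB).const_mul (t / 2 + 1 / t))
      (iAB.const_mul t), integral_const_mul, integral_const_mul, integral_add' iA iB, ePF, eQF,
      eA, eB, hAB] at hm
    have h1 : t * (1 - n * H) ≤ t * (1 - H) ^ n := by gcongr
    have h2 : t * (n * H) ≤ t * (n * c) := by gcongr
    have h3 : (t / 2 + 1 / t) * (1 + 1) = t + 2 / t := by ring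
    linarith
  have hnc : 0 ≤ n * c := mul_nonneg (Nat.cast_nonneg n) (hc0.trans hc)
  rcases hnc.eq_or_lt with h0 | h0
  · rw [← h0, Real.sqrt_zero, mul_zero]
    refine le_of_forall_pos_le_add fun e he => ?_
    have := hbound (2 / e) (by positivity)
    rw [← h0, mul_zero, zero_add, div_div_cancel₀ two_ne_zero] at this
    linarith
  -- `1 / √(n * c)` is, up to a constant, the weight that minimizes the bound
  · have := hbound (1 / √(n * c)) (by positivity)
    have e : 1 / √(n * c) * (n * c) + 2 / (1 / √(n * c)) = 3 * √(n * c) := by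
      have hs := Real.sq_sqrt hnc
      have hpos := Real.sqrt_pos.2 h0
      generalize √(n * c) = r at *
      rw [← hs]
      field_simp
      norm_num
    linarith

end Tensorization

/-! ### Local permutations act on labelled samples -/

section Permutation

variable {𝒳 𝒴 : Type*} {M n : ℕ}

/-- The sample with first components `x`, second components `y` and bin labels `l`. -/
def labelled (x : Fin n → 𝒳) (y : Fin n → 𝒴) (l : Fin n → Fin M) (i : Fin n) :
    𝒳 × 𝒴 × Fin M :=
  (x i, y i, l i)

/-- The partition of the set of labels into singletons. -/
def labelBins (M : ℕ) (m : Fin M) : Set (Fin M) := {m}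

open Classical in
/-- The indices with label `m`. -/
noncomputable def labelIndices (l : Fin n → Fin M) (m : Fin M) : Finset (Fin n) :=
  Finset.univ.filter fun i => l i ∈ labelBins M m

lemma mem_labelIndices {l : Fin n → Fin M} {m : Fin M} {i : Fin n} :
    i ∈ labelIndices l m ↔ l i = m := by
  simp [labelIndices, labelBins]

lemma binnedData_labelled (x : Fin n → 𝒳) (y : Fin n → 𝒴) (l : Fin n → Fin M) :
    binnedData (labelBins M) (labelled x y l) = fun m => ⟨(labelIndices l m).card, fun j =>
      (x ((labelIndices l m).orderEmbOfFin rfl j), y ((labelIndices l m).orderEmbOfFin rfl j))⟩ :=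
  rfl

/-- The enumeration of all indices by a bin and a position in that bin. -/
noncomputable def binEquiv (l : Fin n → Fin M) :
    (Σ m, Fin (labelIndices l m).card) ≃ Fin n :=
  Equiv.ofBijective (fun p => (labelIndices l p.1).orderEmbOfFin rfl p.2) <| by
    constructor
    · rintro ⟨m, j⟩ ⟨m', j'⟩ h
      have h1 := mem_labelIndices.1 ((labelIndices l m).orderEmbOfFin_mem rfl j)
      have h2 := mem_labelIndices.1 ((labelIndices l m').orderEmbOfFin_mem rfl j')
      obtain rfl : m = m' := h1.symm.trans ((congrArg l h).trans h2)
      exact congrArg (Sigma.mk m) (((labelIndices l m).orderEmbOfFin rfl).injective h)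
    · intro i
      have hi : i ∈ Set.range ((labelIndices l (l i)).orderEmbOfFin rfl) := by
        rw [Finset.range_orderEmbOfFin]
        exact mem_labelIndices.2 rfl
      obtain ⟨j, hj⟩ := hi
      exact ⟨⟨l i, j⟩, hj⟩

lemma binEquiv_apply (l : Fin n → Fin M) (m : Fin M) (j : Fin (labelIndices l m).card) :
    binEquiv l ⟨m, j⟩ = (labelIndices l m).orderEmbOfFin rfl j := rfl

/-- The tuples of permutations within the bins. -/
abbrev LocalPerms (l : Fin n → Fin M) : Type :=
  (m : Fin M) → Equiv.Perm (Fin (labelIndices l m).card)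

/-- The permutation of all indices given by a tuple of permutations within the bins. -/
noncomputable def globalPerm (l : Fin n → Fin M) (π : LocalPerms l) : Equiv.Perm (Fin n) :=
  (binEquiv l).symm.trans ((Equiv.Perm.sigmaCongrRight π).trans (binEquiv l))

lemma globalPerm_apply (l : Fin n → Fin M) (π : LocalPerms l) (m : Fin M)
    (j : Fin (labelIndices l m).card) :
    globalPerm l π ((labelIndices l m).orderEmbOfFin rfl j)
      = (labelIndices l m).orderEmbOfFin rfl (π m j) := by
  rw [← binEquiv_apply, ← binEquiv_apply]
  simp [globalPerm]

/-- Multiplicativity of the action, which turns the rank of a permuted sample among its permutations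
into a rank within the orbit of the original sample. -/
lemma globalPerm_mul (l : Fin n → Fin M) (π π' : LocalPerms l) (i : Fin n) :
    globalPerm l (π * π') i = globalPerm l π (globalPerm l π' i) := by
  obtain ⟨⟨m, j⟩, rfl⟩ := (binEquiv l).surjective i
  simp only [binEquiv_apply, globalPerm_apply]
  rfl

lemma label_globalPerm (l : Fin n → Fin M) (π : LocalPerms l) (i : Fin n) :
    l (globalPerm l π i) = l i := by
  obtain ⟨⟨m, j⟩, rfl⟩ := (binEquiv l).surjective i
  have h := fun k => mem_labelIndices.1 ((labelIndices l m).orderEmbOfFin_mem rfl k)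
  rw [binEquiv_apply, globalPerm_apply, h, h]

/-- The test statistic as a function of the first and second components, for fixed labels. -/
noncomputable def labelledStat (f : (Fin M → BinData 𝒳 𝒴) → ℝ) (l : Fin n → Fin M)
    (x : Fin n → 𝒳) (y : Fin n → 𝒴) : ℝ :=
  f (binnedData (labelBins M) (labelled x y l))

open Classical in
lemma permPValue_labelled (f : (Fin M → BinData 𝒳 𝒴) → ℝ) (l : Fin n → Fin M)
    (x : Fin n → 𝒳) (y : Fin n → 𝒴) :
    permPValue f (binnedData (labelBins M) (labelled x y l))
      = (1 / (Fintype.card (LocalPerms l) : ℝ)) * ∑ π : LocalPerms l,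
          if labelledStat f l x y ≤ labelledStat f l x (y ∘ globalPerm l π) then 1 else 0 := by
  have hcard : Fintype.card (LocalPerms l)
      = ∏ m, ((binnedData (labelBins M) (labelled x y l)) m).1 ! := by
    rw [Fintype.card_pi]
    refine Finset.prod_congr rfl fun m _ => ?_
    rw [Fintype.card_perm, Fintype.card_fin]
    rfl
  rw [permPValue, hcard]
  congr 1
  refine Finset.sum_congr rfl fun (π : LocalPerms l) _ => ?_
  have h : (fun m => (binnedData (labelBins M) (labelled x y l) m).permute (π m))
      = binnedData (labelBins M) (labelled x (y ∘ globalPerm l π) l) := by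
    simp only [binnedData_labelled, BinData.permute, Function.comp, globalPerm_apply]
    rfl
  rw [labelledStat, labelledStat, ← h]

open Classical in
/-- For at most a fraction `α` of the indices `π`, the fraction of values of `g` that are at least
`g π` is at most `α`. -/
lemma sum_rank_le {G : Type*} [Fintype G] [Nonempty G] (g : G → ℝ) {α : ℝ} (hα : 0 ≤ α) :
    ∑ π : G, (if (1 / (Fintype.card G : ℝ)) * (∑ π', if g π ≤ g π' then (1 : ℝ) else 0) ≤ α
      then (1 : ℝ) else 0) ≤ α * Fintype.card G := by
  have hG : (0 : ℝ) < Fintype.card G := by exact_mod_cast Fintype.card_pos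
  rw [← Finset.sum_filter, Finset.sum_const, nsmul_one]
  set S := Finset.univ.filter fun π : G =>
    (1 / (Fintype.card G : ℝ)) * (∑ π', if g π ≤ g π' then (1 : ℝ) else 0) ≤ α with hS
  rcases S.eq_empty_or_nonempty with h0 | h0
  · rw [h0]; simp only [Finset.card_empty, Nat.cast_zero]; positivity
  · -- all of `S` ranks at least as high as its minimizer, whose rank is at most `α * card G`
    obtain ⟨π₀, hπ₀, hmin⟩ := S.exists_min_image g h0
    have h1 := (Finset.mem_filter.1 hπ₀).2
    rw [← Finset.sum_filter, Finset.sum_const, nsmul_one, one_div, inv_mul_le_iff₀ hG] at h1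
    have h2 : S ⊆ Finset.univ.filter fun π' => g π₀ ≤ g π' := fun π hπ => by
      simpa using hmin π hπ
    have h3 : (S.card : ℝ) ≤ ((Finset.univ.filter fun π' => g π₀ ≤ g π').card : ℝ) := by
      exact_mod_cast Finset.card_le_card h2
    linarith

lemma sum_permTest_labelled_le (f : (Fin M → BinData 𝒳 𝒴) → ℝ) {α : ℝ} (hα : 0 ≤ α)
    (l : Fin n → Fin M) (x : Fin n → 𝒳) (y : Fin n → 𝒴) :
    ∑ π : LocalPerms l, permTest (labelBins M) f α (labelled x (y ∘ globalPerm l π) l)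
      ≤ α * Fintype.card (LocalPerms l) := by
  classical
  refine le_trans (le_of_eq ?_)
    (sum_rank_le (fun π : LocalPerms l => labelledStat f l x (y ∘ globalPerm l π)) hα)
  refine Finset.sum_congr rfl fun π _ => ?_
  rw [permTest, permPValue_labelled]
  congr 3
  refine Fintype.sum_equiv (Equiv.mulLeft π) _ _ fun π' => ?_
  have h : (y ∘ globalPerm l π) ∘ globalPerm l π' = y ∘ globalPerm l (π * π') := by
    funext i
    simp [globalPerm_mul]
  rw [h]
  rfl

end Permutation

/-! ### Validity of the test under conditional independence within the bins -/

section Validity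

variable {𝒳 𝒴 : Type*} [MeasurableSpace 𝒳] [MeasurableSpace 𝒴] {M n : ℕ}

lemma measurable_sigma_mk {ι : Type*} {β : ι → Type*} [∀ i, MeasurableSpace (β i)] (i : ι) :
    Measurable (Sigma.mk i : β i → Sigma β) :=
  measurable_iff_le_map.2 (iInf_le _ i)

lemma measurable_labelledStat {f : (Fin M → BinData 𝒳 𝒴) → ℝ} (hf : Measurable f)
    (l : Fin n → Fin M) :
    Measurable fun p : (Fin n → 𝒳) × (Fin n → 𝒴) => labelledStat f l p.1 p.2 := by
  simp only [labelledStat, binnedData_labelled]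
  refine hf.comp (measurable_pi_iff.2 fun m => ?_)
  refine (measurable_sigma_mk (β := fun k => Fin k → 𝒳 × 𝒴) (labelIndices l m).card).comp ?_
  exact measurable_pi_iff.2 fun j => by fun_prop

lemma permTest_nonneg {𝒳 𝒴 𝒵 : Type*} (B : Fin M → Set 𝒵) (f : (Fin M → BinData 𝒳 𝒴) → ℝ)
    (α : ℝ) (s : Fin n → 𝒳 × 𝒴 × 𝒵) : 0 ≤ permTest B f α s := by
  rw [permTest]; split_ifs <;> norm_num

lemma permTest_le_one {𝒳 𝒴 𝒵 : Type*} (B : Fin M → Set 𝒵) (f : (Fin M → BinData 𝒳 𝒴) → ℝ)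
    (α : ℝ) (s : Fin n → 𝒳 × 𝒴 × 𝒵) : permTest B f α s ≤ 1 := by
  rw [permTest]; split_ifs <;> norm_num

lemma abs_permTest_le_one {𝒳 𝒴 𝒵 : Type*} (B : Fin M → Set 𝒵) (f : (Fin M → BinData 𝒳 𝒴) → ℝ)
    (α : ℝ) (s : Fin n → 𝒳 × 𝒴 × 𝒵) : |permTest B f α s| ≤ 1 :=
  abs_le.2 ⟨by linarith [permTest_nonneg B f α s], permTest_le_one B f α s⟩

lemma measurable_permTest_labelled {f : (Fin M → BinData 𝒳 𝒴) → ℝ} (hf : Measurable f) (α : ℝ)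
    (l : Fin n → Fin M) : Measurable fun p : (Fin n → 𝒳) × (Fin n → 𝒴) =>
      permTest (labelBins M) f α (labelled p.1 p.2 l) := by
  classical
  simp only [permTest, permPValue_labelled]
  refine Measurable.ite (measurableSet_le (Measurable.const_mul ?_ _) measurable_const)
    measurable_const measurable_const
  refine Finset.measurable_sum _ fun π _ => Measurable.ite (measurableSet_le
    (measurable_labelledStat hf l) ?_) measurable_const measurable_const
  exact (measurable_labelledStat hf l).comp
    (f := fun p : (Fin n → 𝒳) × (Fin n → 𝒴) => (p.1, p.2 ∘ globalPerm l π))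
    (measurable_fst.prodMk (measurable_pi_iff.2 fun i =>
      (measurable_pi_apply _).comp measurable_snd))

lemma measurable_permTest {f : (Fin M → BinData 𝒳 𝒴) → ℝ} (hf : Measurable f) (α : ℝ) :
    Measurable fun s : Fin n → 𝒳 × 𝒴 × Fin M => permTest (labelBins M) f α s := by
  classical
  have e : (fun s : Fin n → 𝒳 × 𝒴 × Fin M => permTest (labelBins M) f α s)
      = fun s => ∑ l : Fin n → Fin M, if (fun i => (s i).2.2) = l then
        permTest (labelBins M) f α (labelled (fun i => (s i).1) (fun i => (s i).2.1) l) else 0 := by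
    funext s
    rw [Finset.sum_ite_eq]
    simp only [Finset.mem_univ, if_true]
    rfl
  rw [e]
  refine Finset.measurable_sum _ fun l _ => Measurable.ite ?_ ?_ measurable_const
  · have hm : Measurable fun s : Fin n → 𝒳 × 𝒴 × Fin M => fun i => (s i).2.2 := by fun_prop
    exact hm (measurableSet_singleton l)
  · exact (measurable_permTest_labelled hf α l).comp
      (f := fun s : Fin n → 𝒳 × 𝒴 × Fin M => (fun i => (s i).1, fun i => (s i).2.1)) (by fun_prop)

/-- The pair `(x, y)` with the label `m` attached. -/
def addLabel (m : Fin M) (w : 𝒳 × 𝒴) : 𝒳 × 𝒴 × Fin M := (w.1, w.2, m)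

lemma measurable_addLabel (m : Fin M) :
    Measurable (addLabel m : 𝒳 × 𝒴 → 𝒳 × 𝒴 × Fin M) := by
  unfold addLabel; fun_prop

lemma restrict_sum_map_addLabel (R : Fin M → Measure (𝒳 × 𝒴)) (m : Fin M) :
    (∑ k, (R k).map (addLabel k)).restrict {w | w.2.2 = m} = (R m).map (addLabel m) := by
  have hm : MeasurableSet {w : 𝒳 × 𝒴 × Fin M | w.2.2 = m} :=
    (measurable_snd.comp measurable_snd) (measurableSet_singleton m)
  ext T hT
  rw [Measure.restrict_apply hT, Measure.finsetSum_apply, Finset.sum_eq_single m]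
  · rw [Measure.map_apply (measurable_addLabel m) (hT.inter hm),
      Measure.map_apply (measurable_addLabel m) hT]
    congr 1
    ext w
    simp [addLabel]
  · intro k _ hk
    rw [Measure.map_apply (measurable_addLabel k) (hT.inter hm)]
    convert measure_empty (μ := R k)
    ext w
    simp [addLabel, hk]
  · simp

/-- Decomposition of a sample of labelled observations according to the labels: given the labels
`l`, the first and the second components are independent families with laws proportional to
`A (l i)` and `D (l i)`. -/
lemma integral_pi_eq_sum_labels (A : Fin M → Measure 𝒳) (D : Fin M → Measure 𝒴)
    [∀ m, IsFiniteMeasure (A m)] [∀ m, IsFiniteMeasure (D m)]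
    {F : (Fin n → 𝒳 × 𝒴 × Fin M) → ℝ} (hF : Measurable F) (hF1 : ∀ s, |F s| ≤ 1) :
    ∫ s, F s ∂(Measure.pi fun _ : Fin n => ∑ m, ((A m).prod (D m)).map (addLabel m))
      = ∑ l : Fin n → Fin M, ∫ p, F (labelled p.1 p.2 l)
          ∂((Measure.pi fun i => A (l i)).prod (Measure.pi fun i => D (l i))) := by
  have : ∀ m, IsFiniteMeasure (((A m).prod (D m)).map (addLabel m)) := fun m => inferInstance
  set Q := ∑ m, ((A m).prod (D m)).map (addLabel m) with hQ
  let S : (Fin n → Fin M) → Set (Fin n → 𝒳 × 𝒴 × Fin M) := fun l =>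
    Set.univ.pi fun i => {w | w.2.2 = l i}
  have hS : ∀ l, MeasurableSet (S l) := fun l => MeasurableSet.univ_pi fun i =>
    (measurable_snd.comp measurable_snd) (measurableSet_singleton (l i))
  have hdisj : Pairwise (Function.onFun Disjoint S) := by
    intro l l' hll
    refine Set.disjoint_left.2 fun s hs hs' => hll (funext fun i => ?_)
    exact (hs i trivial).symm.trans (hs' i trivial)
  have hcover : ⋃ l, S l = Set.univ :=
    Set.eq_univ_of_forall fun s => Set.mem_iUnion.2 ⟨fun i => (s i).2.2, fun i _ => rfl⟩
  have hint := integrable_of_abs_le_one (P := Measure.pi fun _ : Fin n => Q) hF hF1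
  rw [← setIntegral_univ, ← hcover, integral_iUnion_fintype hS hdisj fun l => hint.integrableOn]
  refine Finset.sum_congr rfl fun l _ => ?_
  have hm : Measurable fun (v : Fin n → 𝒳 × 𝒴) i => addLabel (l i) (v i) :=
    measurable_pi_iff.2 fun i => (measurable_addLabel (l i)).comp (measurable_pi_apply i)
  have hmp := (measurePreserving_arrowProdEquivProdArrow 𝒳 𝒴 (Fin n) (fun i => A (l i))
    (fun i => D (l i))).symm
  rw [Measure.restrict_pi_pi]
  simp only [hQ, restrict_sum_map_addLabel]
  rw [← Measure.pi_map_pi fun i => (measurable_addLabel (l i)).aemeasurable,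
    integral_map hm.aemeasurable hF.aestronglyMeasurable, ← hmp.integral_comp']
  rfl

lemma measurePreserving_comp_globalPerm (D : Fin M → Measure 𝒴) [∀ m, IsFiniteMeasure (D m)]
    (l : Fin n → Fin M) (π : LocalPerms l) :
    MeasurePreserving (fun y : Fin n → 𝒴 => y ∘ globalPerm l π)
      (Measure.pi fun i => D (l i)) (Measure.pi fun i => D (l i)) := by
  have h := (measurePreserving_piCongrLeft (α := fun _ => 𝒴) (fun i => D (l i))
    (globalPerm l π)).symm
  have e : ⇑(MeasurableEquiv.piCongrLeft (fun _ => 𝒴) (globalPerm l π)).symm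
      = fun y : Fin n → 𝒴 => y ∘ globalPerm l π := by
    funext y
    rw [MeasurableEquiv.symm_apply_eq]
    funext i
    obtain ⟨k, rfl⟩ := (globalPerm l π).surjective i
    rw [MeasurableEquiv.piCongrLeft_apply_apply]
    rfl
  rw [e] at h
  simpa only [label_globalPerm] using h

/-- Given the labels, the local permutations preserve the law of the sample if the first and
the second components are independent, so that the expectation of the test equals that of its
average over the permutations. -/
lemma integral_permTest_labelled_le (A : Fin M → Measure 𝒳) (D : Fin M → Measure 𝒴)
    [∀ m, IsFiniteMeasure (A m)] [∀ m, IsFiniteMeasure (D m)]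
    {f : (Fin M → BinData 𝒳 𝒴) → ℝ} (hf : Measurable f) {α : ℝ} (hα : 0 ≤ α)
    (l : Fin n → Fin M) {μ : Measure ((Fin n → 𝒳) × (Fin n → 𝒴))}
    (hμ : μ = (Measure.pi fun i => A (l i)).prod (Measure.pi fun i => D (l i))) :
    ∫ p, permTest (labelBins M) f α (labelled p.1 p.2 l) ∂μ ≤ α * ∫ _, (1 : ℝ) ∂μ := by
  have : IsFiniteMeasure μ := hμ ▸ inferInstance
  have hK : (0 : ℝ) < Fintype.card (LocalPerms l) := by
    exact_mod_cast Fintype.card_pos (α := LocalPerms l)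
  have hT := measurable_permTest_labelled hf α l
  have hTi : Integrable (fun p : (Fin n → 𝒳) × (Fin n → 𝒴) =>
      permTest (labelBins M) f α (labelled p.1 p.2 l)) μ :=
    integrable_of_abs_le_one hT fun p => abs_permTest_le_one _ _ _ (labelled p.1 p.2 l)
  have hpres : ∀ π : LocalPerms l, MeasurePreserving
      (fun p : (Fin n → 𝒳) × (Fin n → 𝒴) => (p.1, p.2 ∘ globalPerm l π)) μ μ := fun π => by
    rw [hμ]
    exact (MeasurePreserving.id _).prod (measurePreserving_comp_globalPerm D l π)
  have hinv : ∀ π : LocalPerms l,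
      ∫ p, permTest (labelBins M) f α (labelled p.1 (p.2 ∘ globalPerm l π) l) ∂μ
        = ∫ p, permTest (labelBins M) f α (labelled p.1 p.2 l) ∂μ := fun π => by
    conv_rhs => rw [← (hpres π).map_eq]
    rw [integral_map (hpres π).measurable.aemeasurable hT.aestronglyMeasurable]
  have hintπ : ∀ π : LocalPerms l, Integrable (fun p : (Fin n → 𝒳) × (Fin n → 𝒴) =>
      permTest (labelBins M) f α (labelled p.1 (p.2 ∘ globalPerm l π) l)) μ := fun π =>
    (hpres π).integrable_comp_of_integrable hTi
  have hsum : ∑ π : LocalPerms l,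
        ∫ p, permTest (labelBins M) f α (labelled p.1 (p.2 ∘ globalPerm l π) l) ∂μ
      ≤ ∫ _, α * (Fintype.card (LocalPerms l) : ℝ) ∂μ := by
    rw [← integral_finsetSum _ fun π _ => hintπ π]
    exact integral_mono (integrable_finsetSum _ fun π _ => hintπ π) (integrable_const _)
      fun p => sum_permTest_labelled_le f hα l p.1 p.2
  simp only [hinv, Finset.sum_const, Finset.card_univ, nsmul_eq_mul] at hsum
  refine le_of_mul_le_mul_left (hsum.trans (le_of_eq ?_)) hK
  simp only [integral_const, smul_eq_mul]
  ring

lemma integral_permTest_le_of_independent (A : Fin M → Measure 𝒳) (D : Fin M → Measure 𝒴)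
    [∀ m, IsFiniteMeasure (A m)] [∀ m, IsFiniteMeasure (D m)]
    (hQ : IsProbabilityMeasure (∑ m, ((A m).prod (D m)).map (addLabel m)))
    {f : (Fin M → BinData 𝒳 𝒴) → ℝ} (hf : Measurable f) {α : ℝ} (hα : 0 ≤ α) :
    ∫ s, permTest (labelBins M) f α s
      ∂(Measure.pi fun _ : Fin n => ∑ m, ((A m).prod (D m)).map (addLabel m)) ≤ α := by
  have hone := integral_pi_eq_sum_labels (n := n) A D (F := fun _ => 1) measurable_const
    (fun _ => by simp)
  rw [integral_const, probReal_univ, one_smul] at hone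
  rw [integral_pi_eq_sum_labels A D (measurable_permTest hf α) (abs_permTest_le_one _ f α)]
  refine (Finset.sum_le_sum fun l _ => integral_permTest_labelled_le A D hf hα l rfl).trans ?_
  rw [← Finset.mul_sum, ← hone, mul_one]

end Validity

/-! ### Reduction to bin labels and the level of the test -/

section Level

variable {𝒳 𝒴 𝒵 : Type*} [MeasurableSpace 𝒳] [MeasurableSpace 𝒴] [MeasurableSpace 𝒵] {M n : ℕ}

lemma IsBinning.exists_bin {B : Fin M → Set 𝒵} (hB : IsBinning B) :
    ∃ bin : 𝒵 → Fin M, Measurable bin ∧ ∀ z m, bin z = m ↔ z ∈ B m := by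
  have h : ∀ z, ∃ m, z ∈ B m := fun z => by
    have : z ∈ ⋃ m, B m := hB.iUnion_eq ▸ Set.mem_univ z
    simpa using this
  choose bin hbin using h
  have hiff : ∀ z m, bin z = m ↔ z ∈ B m := fun z m => by
    refine ⟨fun e => e ▸ hbin z, fun hz => ?_⟩
    by_contra hne
    exact Set.disjoint_left.1 (hB.disjoint hne) (hbin z) hz
  refine ⟨bin, measurable_to_countable' fun m => ?_, hiff⟩
  have : bin ⁻¹' {m} = B m := by ext z; simp [hiff]
  rw [this]
  exact hB.measurableSet m

/-- An observation with its conditioning variable `z` replaced by the label of its bin. -/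
def toLabel (bin : 𝒵 → Fin M) (ω : 𝒳 × 𝒴 × 𝒵) : 𝒳 × 𝒴 × Fin M := (ω.1, ω.2.1, bin ω.2.2)

lemma permTest_eq_permTest_toLabel {𝒳 𝒴 𝒵 : Type*} {B : Fin M → Set 𝒵} {bin : 𝒵 → Fin M}
    (hbin : ∀ z m, bin z = m ↔ z ∈ B m) (f : (Fin M → BinData 𝒳 𝒴) → ℝ) (α : ℝ)
    (s : Fin n → 𝒳 × 𝒴 × 𝒵) :
    permTest B f α s = permTest (labelBins M) f α fun i => toLabel bin (s i) := by
  have h : ∀ m, binIndices B s m = binIndices (labelBins M) (fun i => toLabel bin (s i)) m :=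
    fun m => by
      ext i
      simp only [binIndices, Finset.mem_filter, Finset.mem_univ, true_and]
      exact (hbin _ _).symm
  have e : binnedData B s = binnedData (labelBins M) fun i => toLabel bin (s i) := by
    funext m
    exact congrArg (fun I : Finset (Fin n) => (⟨I.card, fun j =>
      ((s (I.orderEmbOfFin rfl j)).1, (s (I.orderEmbOfFin rfl j)).2.1)⟩ : BinData 𝒳 𝒴)) (h m)
  rw [permTest, permTest, e]

lemma smul_cond (ν : Measure 𝒵) [IsFiniteMeasure ν] (T : Set 𝒵) :
    ν T • ProbabilityTheory.cond ν T = ν.restrict T := by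
  by_cases h : ν T = 0
  · rw [h, zero_smul, Measure.restrict_eq_zero.2 h]
  · rw [ProbabilityTheory.cond, smul_smul, ENNReal.mul_inv_cancel h (measure_ne_top ν T), one_smul]

/-- The law of a labelled observation is the mixture, over the bins, of the average of
`κ z ⊗ η z` over the bin. -/
lemma map_toLabel_eq {P : Measure (𝒳 × 𝒴 × 𝒵)} [IsProbabilityMeasure P] {κ : Kernel 𝒵 𝒳}
    {η : Kernel 𝒵 𝒴} [IsMarkovKernel κ] [IsMarkovKernel η]
    (hP : IsCondLaw P (fun ω => (ω.1, ω.2.1)) (fun ω => ω.2.2) (κ ×ₖ η))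
    {B : Fin M → Set 𝒵} (hB : IsBinning B) {bin : 𝒵 → Fin M} (hm : Measurable bin)
    (hbin : ∀ z m, bin z = m ↔ z ∈ B m) {ν : Measure 𝒵} (hν : ν = P.map fun ω => ω.2.2) :
    P.map (toLabel bin) =
      ∑ m, ν (B m) • ((κ ×ₖ η) ∘ₘ (ProbabilityTheory.cond ν (B m))).map (addLabel m) := by
  have : IsProbabilityMeasure ν := hν ▸ Measure.isProbabilityMeasure_map (by fun_prop)
  have hl : Measurable fun p : 𝒵 × 𝒳 × 𝒴 => addLabel (bin p.1) p.2 := by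
    unfold addLabel; fun_prop
  have e : P.map (toLabel bin) =
      (ν ⊗ₘ (κ ×ₖ η)).map fun p : 𝒵 × 𝒳 × 𝒴 => addLabel (bin p.1) p.2 := by
    rw [hν, ← hP, Measure.map_map hl (by fun_prop)]
    rfl
  rw [e]
  ext T hT
  rw [Measure.map_apply hl hT, Measure.compProd_apply (hl hT), Measure.finsetSum_apply,
    ← setLIntegral_univ, ← hB.iUnion_eq, lintegral_iUnion hB.measurableSet hB.disjoint,
    tsum_fintype]
  refine Finset.sum_congr rfl fun m _ => ?_
  rw [Measure.smul_apply, Measure.map_apply (measurable_addLabel m) hT,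
    Measure.bind_apply (measurable_addLabel m hT) (Kernel.aemeasurable _),
    ← lintegral_smul_measure, smul_cond]
  refine setLIntegral_congr_fun (hB.measurableSet m) fun z hz => ?_
  have hz' : bin z = m := (hbin z m).2 hz
  change (κ ×ₖ η) z {w | addLabel (bin z) w ∈ T} = _
  rw [hz']
  rfl

/-- A bound `ε` on the squared Hellinger distances within the bins inflates the level of the local
permutation test by at most `6 √n ε`. -/
lemma integral_permTest_le_of_sqHellinger_le {P : Measure (𝒳 × 𝒴 × 𝒵)} [IsProbabilityMeasure P]
    {κ : Kernel 𝒵 𝒳} {η : Kernel 𝒵 𝒴} [IsMarkovKernel κ] [IsMarkovKernel η]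
    (hP : IsCondLaw P (fun ω => (ω.1, ω.2.1)) (fun ω => ω.2.2) (κ ×ₖ η))
    {B : Fin M → Set 𝒵} (hB : IsBinning B) {f : (Fin M → BinData 𝒳 𝒴) → ℝ} (hf : Measurable f)
    {α : ℝ} (hα : 0 ≤ α) {ε : ℝ} (hε : 0 ≤ ε)
    (hκ : ∀ m, ∀ z ∈ B m, ∀ z' ∈ B m, sqHellinger (κ z) (κ z') ≤ ε)
    (hη : ∀ m, ∀ z ∈ B m, ∀ z' ∈ B m, sqHellinger (η z) (η z') ≤ ε) :
    ∫ s, permTest B f α s ∂(Measure.pi fun _ : Fin n => P) ≤ α + 6 * √n * ε := by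
  obtain ⟨bin, hm, hbin⟩ := hB.exists_bin
  obtain ⟨ν, hν⟩ : ∃ ν : Measure 𝒵, ν = P.map fun ω => ω.2.2 := ⟨_, rfl⟩
  have hνp : IsProbabilityMeasure ν := hν ▸ Measure.isProbabilityMeasure_map (by fun_prop)
  have hlaw := map_toLabel_eq hP hB hm hbin hν
  have hlm : Measurable (toLabel bin : 𝒳 × 𝒴 × 𝒵 → 𝒳 × 𝒴 × Fin M) := by
    unfold toLabel; fun_prop
  have hw : ∑ m, ν (B m) = 1 := by
    rw [← tsum_fintype (L := .unconditional _), ← measure_iUnion hB.disjoint hB.measurableSet,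
      hB.iUnion_eq, measure_univ]
  have hcond : ∀ m, ν (B m) ≠ 0 → IsProbabilityMeasure (ProbabilityTheory.cond ν (B m)) :=
    fun m h => cond_isProbabilityMeasure h
  -- bins of probability zero have the zero measure as conditional law and drop out of all sums
  let A : Fin M → Measure 𝒳 := fun m => ν (B m) • (κ ∘ₘ ProbabilityTheory.cond ν (B m))
  let D : Fin M → Measure 𝒴 := fun m => η ∘ₘ ProbabilityTheory.cond ν (B m)
  have hA : ∀ m, IsFiniteMeasure (A m) := fun m => Measure.smul_finite _ (measure_ne_top ν _)
  have hQ : ∑ m, ((A m).prod (D m)).map (addLabel m) = ∑ m, ν (B m) •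
      ((κ ∘ₘ ProbabilityTheory.cond ν (B m)).prod
        (η ∘ₘ ProbabilityTheory.cond ν (B m))).map (addLabel m) :=
    Finset.sum_congr rfl fun m _ => by rw [Measure.prod_smul_left, Measure.map_smul]
  have hQp : IsProbabilityMeasure (∑ m, ((A m).prod (D m)).map (addLabel m)) := by
    refine ⟨?_⟩
    rw [hQ, Measure.finsetSum_apply, ← hw]
    refine Finset.sum_congr rfl fun m _ => ?_
    by_cases h0 : ν (B m) = 0
    · simp [h0]
    · have := hcond m h0
      rw [Measure.smul_apply, Measure.map_apply (measurable_addLabel m) MeasurableSet.univ,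
        Set.preimage_univ, measure_univ, smul_eq_mul, mul_one]
  have hvar : VarBound (4 * ε ^ 2) (P.map (toLabel bin))
      (∑ m, ((A m).prod (D m)).map (addLabel m)) := by
    rw [hlaw, hQ]
    refine VarBound.sum_smul hw fun m h0 => ?_
    have := hcond m h0
    refine VarBound.map (varBound_mixture (T := B m) ?_ hε (hκ m) (hη m)) (measurable_addLabel m)
    exact ae_cond_mem (hB.measurableSet m)
  have hPp : IsProbabilityMeasure (P.map (toLabel bin)) :=
    Measure.isProbabilityMeasure_map hlm.aemeasurable
  have hTm := measurable_permTest (n := n) hf α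
  have hmap : ∫ s, permTest B f α s ∂(Measure.pi fun _ : Fin n => P)
      = ∫ s, permTest (labelBins M) f α s
        ∂(Measure.pi fun _ : Fin n => P.map (toLabel bin)) := by
    have hpi : Measurable fun (s : Fin n → 𝒳 × 𝒴 × 𝒵) i => toLabel bin (s i) :=
      measurable_pi_iff.2 fun i => hlm.comp (measurable_pi_apply i)
    rw [← Measure.pi_map_pi fun i => hlm.aemeasurable,
      integral_map hpi.aemeasurable hTm.aestronglyMeasurable]
    simp only [permTest_eq_permTest_toLabel hbin]
  have htv := integral_pi_sub_le hvar.sqHellinger_le hTm (permTest_nonneg _ f α)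
    (permTest_le_one _ f α)
  have hval := integral_permTest_le_of_independent (n := n) A D hQp hf hα
  have hsqrt : √(n * (4 * ε ^ 2)) = √n * (2 * ε) := by
    rw [Real.sqrt_mul (Nat.cast_nonneg n), show 4 * ε ^ 2 = (2 * ε) ^ 2 by ring,
      Real.sqrt_sq (by positivity)]
  rw [hsqrt, ← hmap] at htv
  linarith

lemma dist_le_maxDiam {𝒵 : Type*} [MetricSpace 𝒵] {B : Fin M → Set 𝒵}
    (hb : ∀ m, Bornology.IsBounded (B m)) {m : Fin M} {z z' : 𝒵} (hz : z ∈ B m) (hz' : z' ∈ B m) :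
    dist z z' ≤ maxDiam B :=
  (Metric.dist_le_diam_of_mem (hb m) hz hz').trans
    (le_ciSup (f := fun m => Metric.diam (B m)) (Set.finite_range _).bddAbove m)

lemma maxDiam_nonneg {𝒵 : Type*} [MetricSpace 𝒵] (B : Fin M → Set 𝒵) : 0 ≤ maxDiam B :=
  Real.iSup_nonneg fun _ => Metric.diam_nonneg

end Level

end LocalPerm

theorem mainTheorem2 (γ : ℝ) (hγ : 1 ≤ γ) :
    ∃ C : ℝ, 0 < C ∧
      ∀ (𝒳 𝒴 𝒵 : Type*) [MeasurableSpace 𝒳] [MeasurableSpace 𝒴] [MeasurableSpace 𝒵]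
        [MetricSpace 𝒵] (n M : ℕ) (B : Fin M → Set 𝒵),
        LocalPerm.IsBinning B → (∀ m, Bornology.IsBounded (B m)) →
        ∀ f : (Fin M → LocalPerm.BinData 𝒳 𝒴) → ℝ, Measurable f →
        ∀ α : ℝ, 0 < α → α < 1 → ∀ L : ℝ, 0 ≤ L →
        ∀ P ∈ LocalPerm.hellingerNull (𝒳 := 𝒳) (𝒴 := 𝒴) (𝒵 := 𝒵) γ L,
          (γ ≤ 2 →
            ∫ s, LocalPerm.permTest B f α s ∂(Measure.pi fun _ : Fin n => P)
              ≤ α + C * Real.sqrt n * L ^ γ * LocalPerm.maxDiam B ^ γ) ∧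
          (2 < γ →
            ∫ s, LocalPerm.permTest B f α s ∂(Measure.pi fun _ : Fin n => P)
              ≤ α + C * Real.sqrt n * L ^ 2 * LocalPerm.maxDiam B ^ 2) := by
  refine ⟨6 * γ ^ 2, by positivity, ?_⟩
  intro 𝒳 𝒴 𝒵 _ _ _ _ n M B hB hb f hf α hα _ L hL P hP
  obtain ⟨_, κ, η, _, _, -, -, hind, hlip⟩ := hP
  have hh := LocalPerm.maxDiam_nonneg B
  have hd : ∀ m, ∀ z ∈ B m, ∀ z' ∈ B m, L * dist z z' ≤ L * LocalPerm.maxDiam B :=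
    fun m z hz z' hz' => mul_le_mul_of_nonneg_left (LocalPerm.dist_le_maxDiam hb hz hz') hL
  have hLh : 0 ≤ L * LocalPerm.maxDiam B := mul_nonneg hL hh
  constructor
  · intro h2
    refine (LocalPerm.integral_permTest_le_of_sqHellinger_le hind hB hf hα.le
      (ε := (L * LocalPerm.maxDiam B) ^ γ) (by positivity)
      (fun m z hz z' hz' => LocalPerm.sqHellinger_le_of_le_two hγ h2
        ((hlip z z').1.trans (hd m z hz z' hz')))
      (fun m z hz z' hz' => LocalPerm.sqHellinger_le_of_le_two hγ h2
        ((hlip z z').2.trans (hd m z hz z' hz')))).trans ?_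
    rw [Real.mul_rpow hL hh]
    have h6 : (6 : ℝ) ≤ 6 * γ ^ 2 := by nlinarith
    have hnn : 0 ≤ √(n : ℝ) * (L ^ γ * LocalPerm.maxDiam B ^ γ) := by positivity
    nlinarith [mul_le_mul_of_nonneg_right h6 hnn]
  · intro h2
    refine (LocalPerm.integral_permTest_le_of_sqHellinger_le hind hB hf hα.le
      (ε := γ ^ 2 / 4 * (L * LocalPerm.maxDiam B) ^ 2) (by positivity)
      (fun m z hz z' hz' => LocalPerm.sqHellinger_le_of_two_lt h2 hLh
        ((hlip z z').1.trans (hd m z hz z' hz')))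
      (fun m z hz z' hz' => LocalPerm.sqHellinger_le_of_two_lt h2 hLh
        ((hlip z z').2.trans (hd m z hz z' hz')))).trans ?_
    have hnn : 0 ≤ √(n : ℝ) * γ ^ 2 * (L * LocalPerm.maxDiam B) ^ 2 := by positivity
    nlinarith
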